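/- **Definitions.** Let $\Bbbk$ be a field of characteristic $0$, and let $R\subseteq A$ be rings with the same identity. $A=\sigma(R)\langle x_1,\dots,x_n\rangle$ is a *skew PBW extension* of $R$ if $x_1,\dots,x_n\in A\setminus R$; $A$ is a free left $R$-module with basis the monomials $x_1^{\alpha_1}\cdots x_n^{\alpha_n}$ ($\alpha\in\mathbb N^n$); for each $i$ and each $0\ne r\in R$ there is $0\neq c_{i,r}\in R$ with $x_ir-c_{i,r}x_i\in R$; and for all $i,j$ there is $0\ne d_{i,j}\in R$ with $x_jx_i-d_{i,j}x_ix_j\in R+Rx_1+\cdots+Rx_n$. A *differential calculus* over a $\Bbbk$-algebra $A$ is an $\mathbb N$-graded $\Bbbk$-algebra $\Omega A=\bigoplus_n\Omega^nA$ (product $\wedge$) with a degree-one $\Bbbk$-linear map $d$ satisfying $d^2=0$ and the graded Leibniz rule, such that $\Omega^0A=A$ and $\Omega^nA=A\,dA\wedge\cdots\wedge dA$ ($n$ factors $dA$) for all $n$. It is *$n$-dimensional* if $\Omega^nA\ne0$ and $\Omega^mA=0$ for $m>n$, and *connected* if $\ker(d|_A)=\Bbbk$. Let $\mathcal I_mA$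 be the $A$-bimodule of right $A$-linear maps $\Omega^mA\to A$, with $(a\cdot\phi\cdot b)(\omega)=a\phi(b\omega)$, and put $(\phi\cdot\omega)(\omega')=\phi(\omega\wedge\omega')$. A *divergence* is a linear map $\nabla:\mathcal I_1A\to A$ with $\nabla(\phi\cdot a)=\nabla(\phi)a+\phi(da)$; it extends to $\nabla_m:\mathcal I_{m+1}A\to\mathcal I_mA$ by $\nabla_m(\phi)(\omega)=\nabla(\phi\cdot\omega)+(-1)^{m+1}\phi(d\omega)$, and is *flat* if $\nabla\circ\nabla_1=0$. An $n$-dimensional calculus is *integrable* if there are a flat divergence $\nabla$, an algebra automorphism $\nu$ of $A$ and bijective additive (indeed $\Bbbk$-linear) maps $\Theta_k:\Omega^kA\to\mathcal I_{n-k}A$ ($0\le k\le n$) with $\Theta_k(a\omega b)=\nu(a)\cdot\Theta_k(\omega)\cdot b$ and $\Theta_{k+1}\circ d=\nabla_{n-k-1}\circ\Theta_k$ for $0\le k<n$. The algebra $A$ is *differentially smooth* if it is finitely generated, its Gelfand–Kirillov dimension is an integer $n$, and it admits an $n$-dimensional connected integrable differential calculus. **Theorem.** Let $A$ be a $\Bbbk$-algebra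 that is a skew PBW extension $\sigma(\Bbbk[t_1,t_2])\langle x_1,x_2\rangle$ (with $\Bbbk[t_1,t_2]$ a $\Bbbk$-subalgebra) such that $$x_it_j=(a_{ijj}t_j+b_{ij})x_i+p_i\quad(i,j\in\{1,2\}),\qquad x_2x_1=c\,x_1x_2+q_0+q_1x_1+q_2x_2,$$ where all $a_{ijj},b_{ij},p_i,c,q_l$ lie in $\Bbbk$ and $a_{111},a_{122},a_{211},a_{222},c$ are nonzero. Then $A$ is differentially smooth in each of the following cases (scalars not mentioned in a case are unrestricted). * (a) $a_{111}=a_{122}=a_{211}=a_{222}=1$ and one of: 1. $c=1$, $q_1=q_2=0$; 2. $c=1$, $q_1=0\neq q_2$, $b_{11}=b_{12}=0$; 3. $c=1$, $q_2=0\ne q_1$, $b_{21}=b_{22}=0$; 4. $c\neq1$, $p_1=p_2=0$, $q_0=q_1=q_2=0$; 5. $c\ne1$, $p_1=\frac{b_{11}q_2}{c-1}$, $p_2=0$, $q_0=q_1=0\neq q_2$, $b_{11}=b_{12}$; 6. $c\ne1$, $p_1=0$, $p_2=\frac{b_{22}q_1}{c-1}$, $q_0=q_2=0\ne q_1$, $b_{22}=b_{21}$;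 7. $c\ne1$, $p_1=\frac{b_{11}q_2}{c-1}$, $p_2=\frac{b_{22}q_1}{c-1}$, $q_0=\frac{q_1q_2}{c-1}$, $q_1\ne0$, $q_2\neq0$, $b_{11}=b_{12}$, $b_{22}=b_{21}$. * (b) $a_{111}\ne1$, $a_{122}=a_{211}=a_{222}=1$, $p_1=0$, $b_{21}=0$, $q_0=q_2=0$, and either $p_2=0$ and ($b_{22}=0$ or $q_1=0$), or $c=a_{111}$ and $p_2=\frac{b_{22}q_1}{c-1}$. * (c) $a_{122}\ne1$, $a_{111}=a_{211}=a_{222}=1$, $p_1=0$, $b_{22}=0$, $q_0=q_2=0$, and either $p_2=0$ and ($b_{21}=0$ or $q_1=0$), or $c=a_{122}$ and $p_2=\frac{b_{21}q_1}{c-1}$. * (d) $a_{211}\ne1$, $a_{111}=a_{122}=a_{222}=1$, $p_2=0$, $b_{11}=0$, $q_0=q_1=0$, and either $p_1=0$ and ($b_{12}=0$ or $q_2=0$), or $c\in\{a_{211},a_{211}^{-1}\}$ and $p_1=\frac{b_{12}q_2}{c-1}$. * (e) $a_{222}\ne1$, $a_{111}=a_{122}=a_{211}=1$, $p_2=0$,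 $b_{12}=0$, $q_0=q_1=0$, and either $p_1=0$ and ($b_{11}=0$ or $q_2=0$), or $c\in\{a_{222},a_{222}^{-1}\}$ and $p_1=\frac{b_{11}q_2}{c-1}$. * (f) $a_{111}\neq1$, $a_{122}\ne1$, $a_{211}=a_{222}=1$, $p_1=0$, $b_{21}=b_{22}=0$, $q_0=q_2=0$, and either $p_2=0$, or $c=a_{111}=a_{122}$. * (g) $a_{111}\ne1$, $a_{211}\neq1$, $a_{122}=a_{222}=1$, $p_1=p_2=0$, $q_1=q_2=0$, and either $q_0=0$ and $b_{21}=\frac{b_{11}(a_{211}-1)}{a_{111}-1}$, or $a_{111}=a_{211}^{-1}$, $b_{21}\in\{-a_{211}^{-1}b_{11},-a_{211}b_{11}\}$ and ($q_0=0$ or $c=1$). * (h) $a_{111}\ne1$, $a_{222}\neq1$, $a_{122}=a_{211}=1$, $p_1=p_2=0$, $q_0=q_1=q_2=0$, $b_{21}=b_{12}=0$. * (i) $a_{122}\ne1$, $a_{211}\neq1$, $a_{111}=a_{222}=1$, $p_1=p_2=0$, $q_0=q_1=q_2=0$, $b_{11}=b_{22}=0$. * (j) $a_{122}\ne1$, $a_{222}\neq1$,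 $a_{111}=a_{211}=1$, $p_1=p_2=0$, $q_1=q_2=0$, and either $q_0=0$ and $b_{12}=\frac{b_{22}(a_{122}-1)}{a_{222}-1}$, or $a_{222}=a_{122}^{-1}$, $b_{12}\in\{-a_{122}^{-1}b_{22},-a_{122}b_{22}\}$ and ($q_0=0$ or $c=1$). * (k) $a_{211}\ne1$, $a_{222}\neq1$, $a_{111}=a_{122}=1$, $p_2=0$, $b_{11}=b_{12}=0$, $q_0=q_1=0$, and either $p_1=0$, or $a_{211}=a_{222}$ and $c\in\{a_{222},a_{222}^{-1}\}$. * In (l)–(o), $p_1=p_2=0$ and $q_0=q_1=q_2=0$: * (l) $a_{111}=1$, the other three $a$'s $\ne1$, $b_{11}=0$, $b_{12}=\frac{b_{22}(a_{122}-1)}{a_{222}-1}$; * (m) $a_{122}=1$, the other three $a$'s $\neq1$, $b_{12}=0$, $b_{21}=\frac{b_{11}(a_{211}-1)}{a_{111}-1}$; * (n) $a_{211}=1$, the other three $a$'s $\neq1$, $b_{21}=0$, $b_{12}=\frac{b_{22}(a_{122}-1)}{a_{222}-1}$; * (o) $a_{222}=1$, the other three $a$'s $\neq1$, $b_{22}=0$,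 $b_{21}=\frac{b_{11}(a_{211}-1)}{a_{111}-1}$. * (p) all four $a$'s $\ne1$, $p_1=p_2=0$, $q_1=q_2=0$, and one of: 1. $q_0=0$, $b_{12}=\frac{b_{22}(a_{122}-1)}{a_{222}-1}$, $b_{21}=\frac{b_{11}(a_{211}-1)}{a_{111}-1}$; 2. $q_0=0$, $a_{211}=a_{111}^{-1}$, $b_{12}=\frac{b_{22}(a_{122}-1)}{a_{222}-1}$, $b_{21}=-a_{111}^{-1}b_{11}$; 3. $a_{211}=a_{111}^{-1}$, $a_{122}=a_{222}^{-1}$, $b_{21}=-a_{111}^{-1}b_{11}$, $b_{12}=-a_{222}^{-1}b_{22}$, and ($c=1$ or $q_0=0$). -/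

import Mathlib

universe u v

/-! Skew Poincaré–Birkhoff–Witt extensions -/

/-- The standard monomial `x₁^α₁ ⋯ xₙ^αₙ`, the factors being taken in this order. -/
def standardMonomial {A : Type v} [Ring A] {n : ℕ} (x : Fin n → A) (α : Fin n → ℕ) : A :=
  (List.ofFn fun i => x i ^ α i).prod

/-- `A` is a skew PBW extension of `R` in the indeterminates `x₁, …, xₙ`; the embedding of `R` in
`A` is `ι`. -/
structure IsSkewPBWExtension {R : Type u} {A : Type v} [Ring R] [Ring A] (ι : R →+* A) {n : ℕ}
    (x : Fin n → A) : Prop where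
  /-- `R` is a subring of `A`. -/
  injective : Function.Injective ι
  /-- The indeterminates lie outside `R`. -/
  not_mem : ∀ i, x i ∉ ι.range
  /-- `A` is a free left `R`-module on the standard monomials. -/
  basis : ∀ a : A, ∃! f : (Fin n → ℕ) →₀ R, a = f.sum fun α r => ι r * standardMonomial x α
  /-- For `r ≠ 0` there is `c ≠ 0` with `xᵢ r - c xᵢ ∈ R`. -/
  comm_coeff : ∀ (i : Fin n) (r : R), r ≠ 0 → ∃ c : R, c ≠ 0 ∧ x i * ι r - ι c * x i ∈ ι.range
  /-- There is `d ≠ 0` with `xⱼ xᵢ - d xᵢ xⱼ ∈ R + R x₁ + ⋯ + R xₙ`. -/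
  comm_var : ∀ i j : Fin n, ∃ d : R, d ≠ 0 ∧ ∃ (r₀ : R) (r : Fin n → R),
    x j * x i - ι d * x i * x j = ι r₀ + ∑ k, ι (r k) * x k

/-! Differential calculi -/

/-- A differential calculus over the `𝕜`-algebra `A`: a differential graded algebra
`Form = ⨁ₙ degree n` whose degree zero part is (identified by `toForm` with) `A` and which
satisfies the density condition `Ωⁿ A = A dA ∧ ⋯ ∧ dA`. The wedge product is the product of
`Form`. -/
structure DifferentialCalculus (𝕜 : Type u) (A : Type v) [Field 𝕜] [Ring A] [Algebra 𝕜 A] where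
  Form : Type v
  [ring : Ring Form]
  [algebra : Algebra 𝕜 Form]
  degree : ℕ → Submodule 𝕜 Form
  [graded : GradedAlgebra degree]
  toForm : A →ₐ[𝕜] Form
  toForm_injective : Function.Injective toForm
  degree_zero : ∀ ω : Form, ω ∈ degree 0 ↔ ∃ a, toForm a = ω
  d : Form →ₗ[𝕜] Form
  d_mem : ∀ {n : ℕ} {ω : Form}, ω ∈ degree n → d ω ∈ degree (n + 1)
  d_d : ∀ ω : Form, d (d ω) = 0
  leibniz : ∀ {n : ℕ} {ω : Form}, ω ∈ degree n → ∀ η : Form,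
    d (ω * η) = d ω * η + (-1) ^ n * (ω * d η)
  dense : ∀ n : ℕ, degree n = Submodule.span 𝕜
    {ω | ∃ (a : A) (b : Fin n → A), ω = toForm a * (List.ofFn fun i => d (toForm (b i))).prod}

namespace DifferentialCalculus

attribute [instance] DifferentialCalculus.ring DifferentialCalculus.algebra
  DifferentialCalculus.graded

variable {𝕜 : Type u} {A : Type v} [Field 𝕜] [Ring A] [Algebra 𝕜 A]
  (C : DifferentialCalculus 𝕜 A)

/-- The calculus has dimension `n`. -/
def HasDimension (n : ℕ) : Prop :=
  C.degree n ≠ ⊥ ∧ ∀ m, n < m → C.degree m = ⊥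

/-- The kernel of `d` on `Ω⁰ A = A` is `𝕜`. -/
def IsConnected : Prop :=
  ∀ a : A, C.d (C.toForm a) = 0 ↔ ∃ r : 𝕜, algebraMap 𝕜 A r = a

theorem toForm_mem (a : A) : C.toForm a ∈ C.degree 0 := (C.degree_zero _).2 ⟨a, rfl⟩

/-- The wedge product `Ωᵐ A × Ωⁿ A → Ωᵐ⁺ⁿ A`. -/
def wedge {m n : ℕ} (ω : C.degree m) (η : C.degree n) : C.degree (m + n) :=
  ⟨(ω : C.Form) * η, SetLike.mul_mem_graded ω.2 η.2⟩

/-- The left action of `A` on `Ωⁿ A`. -/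
def lsmul {n : ℕ} (a : A) (ω : C.degree n) : C.degree n :=
  ⟨C.toForm a * (ω : C.Form), by
    have h := SetLike.mul_mem_graded (A := C.degree) (C.toForm_mem a) ω.2
    rwa [zero_add] at h⟩

/-- The right action of `A` on `Ωⁿ A`. -/
def rsmul {n : ℕ} (ω : C.degree n) (a : A) : C.degree n :=
  ⟨(ω : C.Form) * C.toForm a, SetLike.mul_mem_graded (A := C.degree) ω.2 (C.toForm_mem a)⟩

/-- The differential `Ωⁿ A → Ωⁿ⁺¹ A`. -/
def diff {n : ℕ} (ω : C.degree n) : C.degree (n + 1) := ⟨C.d ω, C.d_mem ω.2⟩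

/-- The differential `A → Ω¹ A`. -/
def diffZero (a : A) : C.degree 1 := ⟨C.d (C.toForm a), C.d_mem (C.toForm_mem a)⟩

/-! Integral forms -/

/-- `ℐₙ A = Hom_A(Ωⁿ A, A)`, the right `A`-linear maps. -/
def IntegralForm (n : ℕ) : Submodule 𝕜 (C.degree n →ₗ[𝕜] A) where
  carrier := {φ | ∀ ω a, φ (C.rsmul ω a) = φ ω * a}
  add_mem' := by
    intro φ ψ hφ hψ ω a
    simp [hφ ω a, hψ ω a, add_mul]
  zero_mem' := by intro ω a; simp
  smul_mem' := by
    intro c φ hφ ω a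
    simp [hφ ω a]

variable {C}

/-- The right action of `Ωᵐ A` on integral forms: `(φ · ω)(ω') = φ(ω ∧ ω')`. -/
def actForm {m n : ℕ} (φ : C.IntegralForm (m + n)) (ω : C.degree m) :
    C.IntegralForm n :=
  ⟨{ toFun := fun η => φ.1 (C.wedge ω η)
     map_add' := by
      intro η η'
      rw [← map_add]
      exact congrArg φ.1 (Subtype.ext (mul_add _ _ _))
     map_smul' := by
      intro c η
      rw [← map_smul]
      exact congrArg φ.1 (Subtype.ext (mul_smul_comm _ _ _)) }, by
    intro η a
    change φ.1 _ = φ.1 _ * a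
    rw [← φ.2]
    exact congrArg φ.1 (Subtype.ext (mul_assoc _ _ _).symm)⟩

/-- The left action of `A`: `(a · φ)(ω) = a φ(ω)`. -/
def actLeft {n : ℕ} (a : A) (φ : C.IntegralForm n) : C.IntegralForm n :=
  ⟨(LinearMap.mulLeft 𝕜 a).comp φ.1, by
    intro ω b
    change a * φ.1 _ = a * φ.1 _ * b
    rw [φ.2 ω b, mul_assoc]⟩

/-- The right action of `A`: `(φ · b)(ω) = φ(b ω)`. -/
def actRight {n : ℕ} (φ : C.IntegralForm n) (b : A) : C.IntegralForm n :=
  ⟨{ toFun := fun η => φ.1 (C.lsmul b η)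
     map_add' := by
      intro η η'
      rw [← map_add]
      exact congrArg φ.1 (Subtype.ext (mul_add _ _ _))
     map_smul' := by
      intro c η
      rw [← map_smul]
      exact congrArg φ.1 (Subtype.ext (mul_smul_comm _ _ _)) }, by
    intro η a
    change φ.1 _ = φ.1 _ * a
    rw [← φ.2]
    exact congrArg φ.1 (Subtype.ext (mul_assoc _ _ _).symm)⟩

variable (C)

/-- A divergence (hom-connection) on `A`: a linear map `∇ : ℐ₁ A → A` with
`∇(φ · a) = ∇(φ) a + φ(da)`. -/
structure Divergence where
  toMap : C.IntegralForm 1 →ₗ[𝕜] A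
  leibniz : ∀ (φ : C.IntegralForm 1) (a : A),
    toMap (actRight φ a) = toMap φ * a + φ.1 (C.diffZero a)

variable {C}

/-- The extension `∇ₙ : ℐₙ₊₁ A → ℐₙ A` of a divergence,
`∇ₙ(φ)(ω) = ∇(φ · ω) + (-1)ⁿ⁺¹ φ(dω)`. For `n = 0` and `ℐ₀ A = A` this is `∇` itself. -/
def Divergence.ext (D : C.Divergence) {n : ℕ} (φ : C.IntegralForm (n + 1)) :
    C.IntegralForm n :=
  ⟨{ toFun := fun ω => D.toMap (actForm φ ω) + (-1) ^ (n + 1) * φ.1 (C.diff ω)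
     map_add' := by
      intro ω η
      have h1 : actForm φ (ω + η) = actForm φ ω + actForm φ η := by
        ext ζ
        change φ.1 _ = φ.1 _ + φ.1 _
        rw [← map_add]
        exact congrArg φ.1 (Subtype.ext (add_mul _ _ _))
      have h2 : C.diff (ω + η) = C.diff ω + C.diff η := Subtype.ext (map_add _ _ _)
      rw [h1, h2, map_add, map_add, mul_add]
      abel
     map_smul' := by
      intro c ω
      have h1 : actForm φ (c • ω) = c • actForm φ ω := by
        ext ζ
        change φ.1 _ = c • φ.1 _
        rw [← map_smul]
        exact congrArg φ.1 (Subtype.ext (smul_mul_assoc _ _ _))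
      have h2 : C.diff (c • ω) = c • C.diff ω := Subtype.ext (map_smul _ _ _)
      rw [h1, h2, map_smul, map_smul, mul_smul_comm, ← smul_add]
      rfl }, by
    intro ω a
    change D.toMap _ + _ * φ.1 _ = (D.toMap _ + _ * φ.1 _) * a
    have h1 : actForm φ (C.rsmul ω a) = actRight (actForm φ ω) a := by
      ext ζ
      exact congrArg φ.1 (Subtype.ext (mul_assoc _ _ _))
    have h2 : φ.1 (C.diff (C.rsmul ω a)) =
        φ.1 (C.diff ω) * a + (-1) ^ n * φ.1 (C.wedge ω (C.diffZero a)) := by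
      rw [← φ.2]
      have h3 : C.diff (C.rsmul ω a) = C.rsmul (C.diff ω) a +
          ((-1 : 𝕜) ^ n) • C.wedge ω (C.diffZero a) := by
        apply Subtype.ext
        change C.d ((ω : C.Form) * C.toForm a) = C.d ω * C.toForm a +
          ((-1 : 𝕜) ^ n) • ((ω : C.Form) * C.d (C.toForm a))
        rw [C.leibniz ω.2]
        rcases Nat.even_or_odd n with h' | h' <;> simp [h'.neg_one_pow]
      rw [h3, map_add, map_smul]
      rcases Nat.even_or_odd n with h' | h' <;> simp [h'.neg_one_pow]
    rw [h1, h2, D.leibniz]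
    change D.toMap (actForm φ ω) * a + φ.1 (C.wedge ω (C.diffZero a)) + _ = _
    rcases Nat.even_or_odd n with h' | h' <;>
      (simp [pow_succ, h'.neg_one_pow, add_mul]; try abel)⟩

/-- The curvature `∇ ∘ ∇₁` vanishes. -/
def Divergence.IsFlat (D : C.Divergence) : Prop :=
  ∀ φ : C.IntegralForm 2, D.toMap (D.ext φ) = 0

variable (C)

/-- The `n`-dimensional calculus is integrable: there are a flat divergence (so a complex of
integral forms), an automorphism `ν` of `A`, and `A`-bimodule isomorphisms
`Θₖ : Ωᵏ A → ^ν ℐₙ₋ₖ A`, `0 ≤ k ≤ n`, with `Θₖ₊₁ ∘ d = ∇ₙ₋ₖ₋₁ ∘ Θₖ`. The index `n - k` is `m`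
with `k + m = n`. -/
def IsIntegrable (n : ℕ) : Prop :=
  ∃ (D : C.Divergence) (ν : A ≃ₐ[𝕜] A)
    (Θ : ∀ k m : ℕ, k + m = n → (C.degree k ≃ₗ[𝕜] C.IntegralForm m)),
    D.IsFlat ∧
    (∀ (k m : ℕ) (h : k + m = n) (a : A) (ω : C.degree k),
      Θ k m h (C.lsmul a ω) = actLeft (ν a) (Θ k m h ω)) ∧
    (∀ (k m : ℕ) (h : k + m = n) (ω : C.degree k) (a : A),
      Θ k m h (C.rsmul ω a) = actRight (Θ k m h ω) a) ∧
    (∀ (k m : ℕ) (h : k + (m + 1) = n) (h' : (k + 1) + m = n) (ω : C.degree k),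
      Θ (k + 1) m h' (C.diff ω) = D.ext (Θ k (m + 1) h ω))

end DifferentialCalculus

/-! Gelfand–Kirillov dimension and differential smoothness -/

/-- The Gelfand–Kirillov dimension: the supremum, over the finite-dimensional subspaces `V`
containing `1`, of `limsup log (dim Vⁿ) / log n`. -/
noncomputable def gelfandKirillovDim (𝕜 : Type u) (A : Type v) [Field 𝕜] [Ring A] [Algebra 𝕜 A] :
    EReal :=
  ⨆ (V : Submodule 𝕜 A) (_ : FiniteDimensional 𝕜 V) (_ : (1 : A) ∈ V),
    Filter.limsup
      (fun n : ℕ => ((Real.log (Module.finrank 𝕜 ↥(V ^ n)) / Real.log n : ℝ) : EReal))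
      Filter.atTop

/-- `A` is affine of integer Gelfand–Kirillov dimension `n` and admits an `n`-dimensional
connected integrable differential calculus. -/
def IsDifferentiallySmooth (𝕜 : Type u) (A : Type v) [Field 𝕜] [Ring A] [Algebra 𝕜 A] : Prop :=
  Algebra.FiniteType 𝕜 A ∧
    ∃ n : ℕ, gelfandKirillovDim 𝕜 A = ((n : ℝ) : EReal) ∧
      ∃ C : DifferentialCalculus 𝕜 A, C.HasDimension n ∧ C.IsConnected ∧ C.IsIntegrable n

/-! Skew PBW extensions of `𝕜[t₁, t₂]` in two indeterminates -/

/-- The scalars in the relations: `aᵢⱼⱼ`, `bᵢⱼ`, `pᵢ`, `c = c₁₂` and `qₗ = q₁₂⁽ˡ⁾`. -/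
structure PBWScalars (𝕜 : Type u) where
  (a111 a122 a211 a222 : 𝕜)
  (b11 b12 b21 b22 : 𝕜)
  (p1 p2 : 𝕜)
  (c q0 q1 q2 : 𝕜)

namespace PBWScalars

variable {𝕜 : Type u} [Field 𝕜]

/-- The affine-diagonal relations `xᵢ tⱼ = (aᵢⱼⱼ tⱼ + bᵢⱼ) xᵢ + pᵢ` and
`x₂ x₁ = c x₁ x₂ + q₀ + q₁ x₁ + q₂ x₂`, with `aᵢⱼⱼ` and `c` nonzero. Here `t₁, t₂` are the images
of the variables `X 0, X 1`, and `x₁, x₂` are `x 0, x 1`. -/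
structure Relations (S : PBWScalars 𝕜) {A : Type v} [Ring A] [Algebra 𝕜 A]
    (ι : MvPolynomial (Fin 2) 𝕜 →ₐ[𝕜] A) (x : Fin 2 → A) : Prop where
  a111_ne : S.a111 ≠ 0
  a122_ne : S.a122 ≠ 0
  a211_ne : S.a211 ≠ 0
  a222_ne : S.a222 ≠ 0
  c_ne : S.c ≠ 0
  x1_t1 : x 0 * ι (.X 0) = S.a111 • (ι (.X 0) * x 0) + S.b11 • x 0 + algebraMap 𝕜 A S.p1
  x2_t1 : x 1 * ι (.X 0) = S.a211 • (ι (.X 0) * x 1) + S.b21 • x 1 + algebraMap 𝕜 A S.p2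
  x1_t2 : x 0 * ι (.X 1) = S.a122 • (ι (.X 1) * x 0) + S.b12 • x 0 + algebraMap 𝕜 A S.p1
  x2_t2 : x 1 * ι (.X 1) = S.a222 • (ι (.X 1) * x 1) + S.b22 • x 1 + algebraMap 𝕜 A S.p2
  x2_x1 : x 1 * x 0 = S.c • (x 0 * x 1) + algebraMap 𝕜 A S.q0 + S.q1 • x 0 + S.q2 • x 1

variable (S : PBWScalars 𝕜)

def CaseA : Prop :=
  S.a111 = 1 ∧ S.a122 = 1 ∧ S.a211 = 1 ∧ S.a222 = 1 ∧
    ((S.c = 1 ∧ S.q1 = 0 ∧ S.q2 = 0) ∨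
     (S.c = 1 ∧ S.q1 = 0 ∧ S.q2 ≠ 0 ∧ S.b11 = 0 ∧ S.b12 = 0) ∨
     (S.c = 1 ∧ S.q1 ≠ 0 ∧ S.q2 = 0 ∧ S.b21 = 0 ∧ S.b22 = 0) ∨
     (S.p1 = 0 ∧ S.p2 = 0 ∧ S.c ≠ 1 ∧ S.q0 = 0 ∧ S.q1 = 0 ∧ S.q2 = 0) ∨
     (S.p1 = S.b11 * S.q2 / (S.c - 1) ∧ S.p2 = 0 ∧ S.c ≠ 1 ∧ S.q0 = 0 ∧ S.q1 = 0 ∧ S.q2 ≠ 0 ∧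
        S.b11 = S.b12) ∨
     (S.p1 = 0 ∧ S.p2 = S.b22 * S.q1 / (S.c - 1) ∧ S.c ≠ 1 ∧ S.q0 = 0 ∧ S.q2 = 0 ∧ S.q1 ≠ 0 ∧
        S.b22 = S.b21) ∨
     (S.p1 = S.b11 * S.q2 / (S.c - 1) ∧ S.p2 = S.b22 * S.q1 / (S.c - 1) ∧ S.c ≠ 1 ∧
        S.q0 = S.q1 * S.q2 / (S.c - 1) ∧ S.q1 ≠ 0 ∧ S.q2 ≠ 0 ∧ S.b11 = S.b12 ∧ S.b22 = S.b21))

def CaseB : Prop :=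
  S.a111 ≠ 1 ∧ S.a122 = 1 ∧ S.a211 = 1 ∧ S.a222 = 1 ∧
    ((S.p1 = 0 ∧ S.p2 = 0 ∧ S.b21 = 0 ∧ S.q0 = 0 ∧ S.q2 = 0 ∧ (S.b22 = 0 ∨ S.q1 = 0)) ∨
     (S.p1 = 0 ∧ S.p2 = S.b22 * S.q1 / (S.c - 1) ∧ S.b21 = 0 ∧ S.q0 = 0 ∧ S.q2 = 0 ∧
        S.c = S.a111))

def CaseC : Prop :=
  S.a111 = 1 ∧ S.a122 ≠ 1 ∧ S.a211 = 1 ∧ S.a222 = 1 ∧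
    ((S.p1 = 0 ∧ S.p2 = 0 ∧ S.b22 = 0 ∧ S.q0 = 0 ∧ S.q2 = 0 ∧ (S.b21 = 0 ∨ S.q1 = 0)) ∨
     (S.p1 = 0 ∧ S.p2 = S.b21 * S.q1 / (S.c - 1) ∧ S.b22 = 0 ∧ S.q0 = 0 ∧ S.q2 = 0 ∧
        S.c = S.a122))

def CaseD : Prop :=
  S.a111 = 1 ∧ S.a122 = 1 ∧ S.a211 ≠ 1 ∧ S.a222 = 1 ∧
    ((S.p1 = 0 ∧ S.p2 = 0 ∧ S.b11 = 0 ∧ S.q0 = 0 ∧ S.q1 = 0 ∧ (S.b12 = 0 ∨ S.q2 = 0)) ∨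
     (S.p1 = S.b12 * S.q2 / (S.c - 1) ∧ S.p2 = 0 ∧ S.b11 = 0 ∧ S.q0 = 0 ∧ S.q1 = 0 ∧
        (S.c = S.a211 ∨ S.c = S.a211⁻¹)))

def CaseE : Prop :=
  S.a111 = 1 ∧ S.a122 = 1 ∧ S.a211 = 1 ∧ S.a222 ≠ 1 ∧
    ((S.p1 = 0 ∧ S.p2 = 0 ∧ S.b12 = 0 ∧ S.q0 = 0 ∧ S.q1 = 0 ∧ (S.b11 = 0 ∨ S.q2 = 0)) ∨
     (S.p1 = S.b11 * S.q2 / (S.c - 1) ∧ S.p2 = 0 ∧ S.b12 = 0 ∧ S.q0 = 0 ∧ S.q1 = 0 ∧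
        (S.c = S.a222 ∨ S.c = S.a222⁻¹)))

def CaseF : Prop :=
  S.a111 ≠ 1 ∧ S.a122 ≠ 1 ∧ S.a211 = 1 ∧ S.a222 = 1 ∧
    ((S.p1 = 0 ∧ S.p2 = 0 ∧ S.b21 = 0 ∧ S.b22 = 0 ∧ S.q0 = 0 ∧ S.q2 = 0) ∨
     (S.p1 = 0 ∧ S.b21 = 0 ∧ S.b22 = 0 ∧ S.q0 = 0 ∧ S.q2 = 0 ∧ S.a111 = S.a122 ∧
        S.c = S.a111))

def CaseG : Prop :=
  S.a111 ≠ 1 ∧ S.a122 = 1 ∧ S.a211 ≠ 1 ∧ S.a222 = 1 ∧ S.p1 = 0 ∧ S.p2 = 0 ∧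
    ((S.q0 = 0 ∧ S.q1 = 0 ∧ S.q2 = 0 ∧ S.b21 = S.b11 * (S.a211 - 1) / (S.a111 - 1)) ∨
     (S.a111 = S.a211⁻¹ ∧ S.q1 = 0 ∧ S.q2 = 0 ∧
        (S.b21 = -S.a211⁻¹ * S.b11 ∨ S.b21 = -S.a211 * S.b11) ∧ (S.q0 = 0 ∨ S.c = 1)))

def CaseH : Prop :=
  S.a111 ≠ 1 ∧ S.a122 = 1 ∧ S.a211 = 1 ∧ S.a222 ≠ 1 ∧ S.p1 = 0 ∧ S.p2 = 0 ∧
    S.q0 = 0 ∧ S.q1 = 0 ∧ S.q2 = 0 ∧ S.b21 = 0 ∧ S.b12 = 0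

def CaseI : Prop :=
  S.a111 = 1 ∧ S.a122 ≠ 1 ∧ S.a211 ≠ 1 ∧ S.a222 = 1 ∧ S.p1 = 0 ∧ S.p2 = 0 ∧
    S.q0 = 0 ∧ S.q1 = 0 ∧ S.q2 = 0 ∧ S.b11 = 0 ∧ S.b22 = 0

def CaseJ : Prop :=
  S.a111 = 1 ∧ S.a122 ≠ 1 ∧ S.a211 = 1 ∧ S.a222 ≠ 1 ∧ S.p1 = 0 ∧ S.p2 = 0 ∧
    ((S.q0 = 0 ∧ S.q1 = 0 ∧ S.q2 = 0 ∧ S.b12 = S.b22 * (S.a122 - 1) / (S.a222 - 1)) ∨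
     (S.a222 = S.a122⁻¹ ∧ S.q1 = 0 ∧ S.q2 = 0 ∧
        (S.b12 = -S.a122⁻¹ * S.b22 ∨ S.b12 = -S.a122 * S.b22) ∧ (S.q0 = 0 ∨ S.c = 1)))

def CaseK : Prop :=
  S.a111 = 1 ∧ S.a122 = 1 ∧ S.a211 ≠ 1 ∧ S.a222 ≠ 1 ∧
    ((S.p1 = 0 ∧ S.p2 = 0 ∧ S.b11 = 0 ∧ S.b12 = 0 ∧ S.q0 = 0 ∧ S.q1 = 0) ∨
     (S.p2 = 0 ∧ S.b11 = 0 ∧ S.b12 = 0 ∧ S.q0 = 0 ∧ S.q1 = 0 ∧ S.a211 = S.a222 ∧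
        (S.c = S.a222 ∨ S.c = S.a222⁻¹)))

def CaseL : Prop :=
  S.a111 = 1 ∧ S.a122 ≠ 1 ∧ S.a211 ≠ 1 ∧ S.a222 ≠ 1 ∧ S.p1 = 0 ∧ S.p2 = 0 ∧
    S.q0 = 0 ∧ S.q1 = 0 ∧ S.q2 = 0 ∧ S.b11 = 0 ∧
    S.b12 = S.b22 * (S.a122 - 1) / (S.a222 - 1)

def CaseM : Prop :=
  S.a111 ≠ 1 ∧ S.a122 = 1 ∧ S.a211 ≠ 1 ∧ S.a222 ≠ 1 ∧ S.p1 = 0 ∧ S.p2 = 0 ∧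
    S.q0 = 0 ∧ S.q1 = 0 ∧ S.q2 = 0 ∧ S.b12 = 0 ∧
    S.b21 = S.b11 * (S.a211 - 1) / (S.a111 - 1)

def CaseN : Prop :=
  S.a111 ≠ 1 ∧ S.a122 ≠ 1 ∧ S.a211 = 1 ∧ S.a222 ≠ 1 ∧ S.p1 = 0 ∧ S.p2 = 0 ∧
    S.q0 = 0 ∧ S.q1 = 0 ∧ S.q2 = 0 ∧ S.b21 = 0 ∧
    S.b12 = S.b22 * (S.a122 - 1) / (S.a222 - 1)

def CaseO : Prop :=
  S.a111 ≠ 1 ∧ S.a122 ≠ 1 ∧ S.a211 ≠ 1 ∧ S.a222 = 1 ∧ S.p1 = 0 ∧ S.p2 = 0 ∧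
    S.q0 = 0 ∧ S.q1 = 0 ∧ S.q2 = 0 ∧ S.b22 = 0 ∧
    S.b21 = S.b11 * (S.a211 - 1) / (S.a111 - 1)

def CaseP : Prop :=
  S.a111 ≠ 1 ∧ S.a122 ≠ 1 ∧ S.a211 ≠ 1 ∧ S.a222 ≠ 1 ∧ S.p1 = 0 ∧ S.p2 = 0 ∧
    ((S.q0 = 0 ∧ S.q1 = 0 ∧ S.q2 = 0 ∧ S.b12 = S.b22 * (S.a122 - 1) / (S.a222 - 1) ∧
        S.b21 = S.b11 * (S.a211 - 1) / (S.a111 - 1)) ∨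
     (S.q0 = 0 ∧ S.q1 = 0 ∧ S.q2 = 0 ∧ S.a211 = S.a111⁻¹ ∧
        S.b12 = S.b22 * (S.a122 - 1) / (S.a222 - 1) ∧ S.b21 = -S.a111⁻¹ * S.b11) ∨
     (S.q1 = 0 ∧ S.q2 = 0 ∧ S.a211 = S.a111⁻¹ ∧ S.a122 = S.a222⁻¹ ∧
        S.b21 = -S.a111⁻¹ * S.b11 ∧ S.b12 = -S.a222⁻¹ * S.b22 ∧ (S.c = 1 ∨ S.q0 = 0)))

/-- The scalars satisfy one of the sixteen sets of conditions (a)–(p). -/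
def IsAdmissible : Prop :=
  S.CaseA ∨ S.CaseB ∨ S.CaseC ∨ S.CaseD ∨ S.CaseE ∨ S.CaseF ∨ S.CaseG ∨ S.CaseH ∨
    S.CaseI ∨ S.CaseJ ∨ S.CaseK ∨ S.CaseL ∨ S.CaseM ∨ S.CaseN ∨ S.CaseO ∨ S.CaseP

end PBWScalars

-- Write u = (t₁, t₂, x₁, x₂). The ordered monomials in u form a 𝕜-basis of A. The calculus is the
-- free right A-module on ordered products du_I, with a duⱼ = duⱼ σⱼ(a) for automorphisms σⱼ of A
-- and da = ∑ duⱼ ∂ⱼ(a) for twisted derivations ∂ⱼ dual to the uⱼ. Applying d to the relations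
-- dictates σⱼ on generators: x₁t₁ = (a₁₁₁t₁ + b₁₁)x₁ + p₁ forces σ_{t₁}(x₁) = a₁₁₁x₁ and σ_{x₁}(t₁)
-- = a₁₁₁⁻¹(t₁ - b₁₁), and similarly for the other pairs. So the question is whether these affine
-- substitutions respect the relations.
--
-- This is a question about scalars. Nearly all the identities needed hold automatically: rewriting
-- xᵢt₁t₂ and x₂x₁tⱼ in two ways and comparing coordinates in the basis yields them
-- (`PBWScalars.Commutation.consistent`). The exception is (c - 1)q₀ = q₁q₂, needed for σ_{x₁} and
-- σ_{x₂} to preserve the relation for x₂x₁. It is all that is extracted from the list of cases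
-- (`PBWScalars.IsAdmissible.c_sub_one_mul_q0`).
--
-- Homomorphisms out of A come from a universal property (`PBWScalars.Commutation.exists_algHom`).
-- Mapping A to upper triangular 2 × 2 matrices over A produces σⱼ and ∂ⱼ at once; their commutation
-- rules are then checked on generators (`PBWScalars.Commutation.exists_twistedPartials`).
--
-- Integrability is formal. The coefficient π of the top form is right A-linear, and (ω, η) ↦ π(ω ∧
-- η) is perfect because du_I meets the top degree only against du_{Iᶜ}
-- (`TwistedPartials.pairing_bijective`). Transporting d along this pairing gives the divergence,
-- whose flatness is d² = 0. For connectedness, σⱼ(uⱼ) = uⱼ makes ∂ⱼ act on powers of uⱼ as an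
-- ordinary derivative, so in characteristic 0 only constants are killed by all ∂ⱼ. The
-- Gelfand–Kirillov dimension is 4 because the number of ordered monomials of degree at most N grows
-- like N⁴.

universe w

/-! ### Integrability from a perfect pairing into the top degree -/

namespace DifferentialCalculus

variable {𝕜 : Type u} {A : Type v} [Field 𝕜] [Ring A] [Algebra 𝕜 A]
  (C : DifferentialCalculus 𝕜 A)

/-- A right `A`-linear functional `π` on forms turns `ω` into the integral form `η ↦ π (ω ∧ η)`. -/
def pairing (π : C.Form →ₗ[𝕜] A) (hπ : ∀ ω a, π (ω * C.toForm a) = π ω * a) (k m : ℕ) :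
    C.degree k →ₗ[𝕜] C.IntegralForm m where
  toFun ω :=
    ⟨{ toFun := fun η => π (ω * η)
       map_add' := fun η η' => by simp [mul_add]
       map_smul' := fun c η => by simp }, fun η a => by
      change π (ω * (η * C.toForm a)) = _
      rw [← mul_assoc, hπ]; rfl⟩
  map_add' ω ω' := by
    ext η
    change π ((ω + ω' : C.Form) * η) = π (ω * η) + π (ω' * η)
    simp [add_mul]
  map_smul' c ω := by
    ext η
    change π ((c • ω : C.Form) * η) = c • π (ω * η)
    simp

variable {C}

theorem IntegralForm.ext' {m : ℕ} {φ ψ : C.IntegralForm m} (h : ∀ η, φ.1 η = ψ.1 η) : φ = ψ :=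
  Subtype.ext (LinearMap.ext h)

theorem actRight_pairing (π : C.Form →ₗ[𝕜] A) (hπ : ∀ ω a, π (ω * C.toForm a) = π ω * a)
    {k m : ℕ} (ω : C.degree k) (a : A) :
    actRight (C.pairing π hπ k m ω) a = C.pairing π hπ k m (C.rsmul ω a) :=
  IntegralForm.ext' fun η => congrArg π (mul_assoc (ω : C.Form) (C.toForm a) η).symm

theorem actForm_pairing (π : C.Form →ₗ[𝕜] A) (hπ : ∀ ω a, π (ω * C.toForm a) = π ω * a)
    {k l m : ℕ} (ω : C.degree k) (η : C.degree l) :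
    actForm (C.pairing π hπ k (l + m) ω) η = C.pairing π hπ (k + l) m (C.wedge ω η) :=
  IntegralForm.ext' fun ζ => congrArg π (mul_assoc (ω : C.Form) η ζ).symm

theorem actLeft_pairing (π : C.Form →ₗ[𝕜] A) (hπ : ∀ ω a, π (ω * C.toForm a) = π ω * a)
    {ν : A → A} (hν : ∀ a ω, π (C.toForm a * ω) = ν a * π ω) {k m : ℕ} (ω : C.degree k) (a : A) :
    actLeft (ν a) (C.pairing π hπ k m ω) = C.pairing π hπ k m (C.lsmul a ω) := by
  apply IntegralForm.ext'
  intro η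
  change ν a * π (ω * η) = π (C.toForm a * ω * η)
  rw [mul_assoc, hν]

/-- The factor (-1)^N cancels the sign of the graded Leibniz rule, which turns ω ↦ π(dω) into
something obeying the unsigned rule of a divergence. -/
theorem pairing_diff_rsmul (π : C.Form →ₗ[𝕜] A) (hπ : ∀ ω a, π (ω * C.toForm a) = π ω * a)
    {N : ℕ} (ω : C.degree N) (a : A) :
    (-1) ^ N * π (C.d (C.rsmul ω a : C.degree N)) = (-1) ^ N * π (C.d ω) * a +
      (C.pairing π hπ N 1 ω).1 (C.diffZero a) := by
  change (-1) ^ N * π (C.d (ω * C.toForm a)) = _ + π (ω * C.d (C.toForm a))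
  rw [C.leibniz ω.2]
  rcases Nat.even_or_odd N with h | h <;> simp [h.neg_one_pow, hπ, add_comm]

/-- The divergence obtained by transporting `d` along a perfect pairing. -/
noncomputable def divergenceOfPairing {N : ℕ} (π : C.Form →ₗ[𝕜] A)
    (hπ : ∀ ω a, π (ω * C.toForm a) = π ω * a) (e : C.degree N ≃ₗ[𝕜] C.IntegralForm 1)
    (he : ∀ ω, e ω = C.pairing π hπ N 1 ω) : C.Divergence where
  toMap :=
    { toFun := fun φ => (-1) ^ N * π (C.d (e.symm φ : C.degree N))
      map_add' := fun φ ψ => by simp [mul_add]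
      map_smul' := fun c φ => by simp }
  leibniz φ a := by
    obtain ⟨ω, rfl⟩ := e.surjective φ
    have h := pairing_diff_rsmul π hπ ω a
    rw [← he] at h
    have h1 : e.symm (actRight (e ω) a) = C.rsmul ω a := by
      rw [LinearEquiv.symm_apply_eq, he, he, actRight_pairing]
    simpa only [LinearMap.coe_mk, AddHom.coe_mk, h1, LinearEquiv.symm_apply_apply] using h

theorem divergenceOfPairing_pairing {N : ℕ} (π : C.Form →ₗ[𝕜] A)
    (hπ : ∀ ω a, π (ω * C.toForm a) = π ω * a) (e : C.degree N ≃ₗ[𝕜] C.IntegralForm 1)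
    (he : ∀ ω, e ω = C.pairing π hπ N 1 ω) (ω : C.degree N) :
    (divergenceOfPairing π hπ e he).toMap (C.pairing π hπ N 1 ω) = (-1) ^ N * π (C.d ω) := by
  change (-1) ^ N * π (C.d (e.symm (C.pairing π hπ N 1 ω) : C.degree N)) = _
  rw [← he, LinearEquiv.symm_apply_apply]

/-- The divergence of a perfect pairing corresponds to `d`, up to sign. -/
theorem ext_divergenceOfPairing {N k m : ℕ} (π : C.Form →ₗ[𝕜] A)
    (hπ : ∀ ω a, π (ω * C.toForm a) = π ω * a) (e : C.degree N ≃ₗ[𝕜] C.IntegralForm 1)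
    (he : ∀ ω, e ω = C.pairing π hπ N 1 ω) (h : k + m = N) (ω : C.degree k) :
    (divergenceOfPairing π hπ e he).ext (C.pairing π hπ k (m + 1) ω) =
      (-1 : 𝕜) ^ N • C.pairing π hπ (k + 1) m (C.diff ω) := by
  subst h
  apply IntegralForm.ext'
  intro η
  change (divergenceOfPairing π hπ e he).toMap (actForm (C.pairing π hπ k (m + 1) ω) η) +
    (-1) ^ (m + 1) * π (ω * C.d η) = (-1 : 𝕜) ^ (k + m) • π (C.d ω * η)
  rw [actForm_pairing, divergenceOfPairing_pairing]
  change (-1) ^ (k + m) * π (C.d (ω * η)) + _ = _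
  rw [C.leibniz ω.2]
  rcases Nat.even_or_odd k with hk | hk <;> rcases Nat.even_or_odd m with hm | hm <;>
    simp [pow_add, hk.neg_one_pow, hm.neg_one_pow]

/-- Taking the extension of a divergence commutes with scalars. -/
theorem Divergence.ext_smul (D : C.Divergence) {m : ℕ} (c : 𝕜) (φ : C.IntegralForm (m + 1)) :
    D.ext (c • φ) = c • D.ext φ := by
  apply IntegralForm.ext'
  intro η
  change D.toMap (actForm (c • φ) η) + (-1) ^ (m + 1) * (c • φ.1 (C.diff η)) =
    c • (D.toMap (actForm φ η) + (-1) ^ (m + 1) * φ.1 (C.diff η))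
  have h : actForm (c • φ) η = c • actForm φ η := rfl
  rw [h, map_smul, smul_add, mul_smul_comm]

theorem actRight_smul {m : ℕ} (c : 𝕜) (φ : C.IntegralForm m) (a : A) :
    actRight (c • φ) a = c • actRight φ a := rfl

theorem actLeft_smul {m : ℕ} (c : 𝕜) (φ : C.IntegralForm m) (a : A) :
    actLeft a (c • φ) = c • actLeft a φ :=
  IntegralForm.ext' fun η => mul_smul_comm c a (φ.1 η)

/-- A calculus with a perfect pairing into its top degree is integrable. -/
theorem isIntegrable_of_pairing {N : ℕ} (π : C.Form →ₗ[𝕜] A) (ν : A ≃ₐ[𝕜] A)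
    (hπ : ∀ ω a, π (ω * C.toForm a) = π ω * a) (hν : ∀ a ω, π (C.toForm a * ω) = ν a * π ω)
    (hbij : ∀ k m, k + m = N + 2 → Function.Bijective (C.pairing π hπ k m)) :
    C.IsIntegrable (N + 2) := by
  -- The divergence matches d only up to ε = (-1)^(N+1). Rescaling the pairing in degree k by ε^k
  -- absorbs this sign.
  have hunit : ∀ k : ℕ, (-1 : 𝕜) ^ ((N + 1) * k) ≠ 0 := fun k => pow_ne_zero _ (by simp)
  let e : C.degree (N + 1) ≃ₗ[𝕜] C.IntegralForm 1 :=
    LinearEquiv.ofBijective _ (hbij (N + 1) 1 rfl)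
  have he : ∀ ω, e ω = C.pairing π hπ (N + 1) 1 ω := fun ω => rfl
  let Θ : ∀ k m : ℕ, k + m = N + 2 → (C.degree k ≃ₗ[𝕜] C.IntegralForm m) := fun k m h =>
    (LinearEquiv.ofBijective _ (hbij k m h)).trans
      (LinearEquiv.smulOfNeZero 𝕜 (C.IntegralForm m) _ (hunit k))
  have hΘ : ∀ k m h ω, Θ k m h ω = (-1 : 𝕜) ^ ((N + 1) * k) • C.pairing π hπ k m ω :=
    fun k m h ω => rfl
  refine ⟨divergenceOfPairing π hπ e he, ν, Θ, ?_, ?_, ?_, ?_⟩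
  -- Every integral 2-form is a pairing with some ω, so the curvature is ±π(d(dω)).
  · intro φ
    obtain ⟨ω, rfl⟩ := (hbij N 2 rfl).2 φ
    rw [ext_divergenceOfPairing π hπ e he rfl, map_smul, divergenceOfPairing_pairing]
    change _ • (_ * π (C.d (C.d (ω : C.Form)))) = _
    rw [C.d_d]
    simp
  · intro k m h a ω
    rw [hΘ k m h, hΘ k m h, actLeft_smul, actLeft_pairing π hπ hν]
  · intro k m h ω a
    rw [hΘ k m h, hΘ k m h, actRight_smul, actRight_pairing]
  · intro k m h h' ω
    rw [hΘ _ _ h', hΘ _ _ h, Divergence.ext_smul, ext_divergenceOfPairing π hπ e he (by omega),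
      smul_smul, mul_add, mul_one, pow_add]

end DifferentialCalculus

/-! ### Twisted partial derivatives and the signs of reordering -/

/-- Twisted partial derivatives `∂ᵢ` on `A` along commuting automorphisms `σᵢ`, dual to a family of
elements `uᵢ`: the data of a differential calculus with `duᵢ` as a free basis of `Ω¹ A`, in which
`a duᵢ = duᵢ σᵢ(a)`. -/
structure TwistedPartials (𝕜 : Type u) (A : Type v) [Field 𝕜] [Ring A] [Algebra 𝕜 A] (n : ℕ) where
  aut : Fin n → A ≃ₐ[𝕜] A
  der : Fin n → A →ₗ[𝕜] A
  coeff : Fin n → Fin n → 𝕜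
  gen : Fin n → A
  aut_comm : ∀ i j, aut i * aut j = aut j * aut i
  der_mul : ∀ i a b, der i (a * b) = aut i a * der i b + der i a * b
  der_aut : ∀ j k a, der k (aut j a) = coeff j k • aut j (der k a)
  der_der : ∀ j k a, der k (der j a) = coeff j k • der j (der k a)
  coeff_mul : ∀ j k, coeff j k * coeff k j = 1
  der_gen : ∀ j i, der j (gen i) = if i = j then 1 else 0

namespace TwistedPartials

variable {𝕜 : Type u} {A : Type v} [Field 𝕜] [Ring A] [Algebra 𝕜 A] {n : ℕ}
  (D : TwistedPartials 𝕜 A n)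

theorem der_one (i : Fin n) : D.der i 1 = 0 := by
  have h := D.der_mul i 1 1
  simpa using h

theorem coeff_ne_zero (j k : Fin n) : D.coeff j k ≠ 0 := fun h => by
  simpa [h] using D.coeff_mul j k

/-- The composition of the automorphisms indexed by `J`. -/
def autProd (J : Finset (Fin n)) : A ≃ₐ[𝕜] A :=
  J.noncommProd D.aut fun i _ j _ _ => D.aut_comm i j

theorem autProd_empty : D.autProd ∅ = 1 := rfl

theorem autProd_union {I J : Finset (Fin n)} (h : Disjoint I J) (a : A) :
    D.autProd (I ∪ J) a = D.autProd I (D.autProd J a) := by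
  have := Finset.noncommProd_union_of_disjoint h D.aut fun i _ j _ _ => D.aut_comm i j
  exact congrArg (fun f : A ≃ₐ[𝕜] A => f a) this

theorem autProd_singleton (j : Fin n) : D.autProd {j} = D.aut j :=
  Finset.noncommProd_singleton _ _

theorem der_autProd (J : Finset (Fin n)) (k : Fin n) (a : A) :
    D.der k (D.autProd J a) = (∏ j ∈ J, D.coeff j k) • D.autProd J (D.der k a) := by
  induction J using Finset.induction_on generalizing a with
  | empty => simp [autProd_empty]
  | insert j J hj ih =>
    rw [Finset.insert_eq, autProd_union _ (by simpa using hj),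
      autProd_union _ (by simpa using hj), autProd_singleton, D.der_aut, ih, map_smul, smul_smul,
      Finset.prod_union (by simpa using hj), Finset.prod_singleton]

/-- The factor by which `duᵢ ∧ duⱼ` differs from the ordered product of `duᵢ` and `duⱼ`. -/
def swap (i j : Fin n) : 𝕜 := if i < j then 1 else if i = j then 0 else -D.coeff j i

/-- This is the twisted anticommutation of duₖ and duⱼ; it is symmetric in the two indices because
`coeff j k` and `coeff k j` are inverse to each other. -/
theorem swap_comm (k j : Fin n) : D.swap k j = -D.coeff j k * D.swap j k := by
  unfold swap
  rcases lt_trichotomy k j with h | rfl | h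
  · simp [h, h.not_gt, h.ne', D.coeff_mul]
  · simp
  · simp [h, h.not_gt, h.ne']

/-- The factor by which `du_I ∧ du_J` differs from `du_{I ∪ J}`. -/
def sign (I J : Finset (Fin n)) : 𝕜 := ∏ i ∈ I, ∏ j ∈ J, D.swap i j

theorem sign_empty_left (J : Finset (Fin n)) : D.sign ∅ J = 1 := rfl

theorem sign_empty_right (I : Finset (Fin n)) : D.sign I ∅ = 1 := by simp [sign]

theorem sign_singleton (i j : Fin n) : D.sign {i} {j} = D.swap i j := by simp [sign]

/-- A repeated index contributes the factor `swap i i = 0`, and all other factors are units. Thus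
duᵢ ∧ duᵢ = 0 is built into the sign and products need no case distinction. -/
theorem sign_eq_zero_iff {I J : Finset (Fin n)} : D.sign I J = 0 ↔ ¬ Disjoint I J := by
  simp only [sign, Finset.prod_eq_zero_iff, Finset.not_disjoint_iff]
  constructor
  · rintro ⟨i, hi, j, hj, h⟩
    refine ⟨i, hi, ?_⟩
    unfold swap at h
    split_ifs at h with h1 h2
    · simp at h
    · exact h2 ▸ hj
    · exact absurd (neg_eq_zero.1 h) (D.coeff_ne_zero _ _)
  · rintro ⟨i, hi, hj⟩
    exact ⟨i, hi, i, hj, by simp [swap]⟩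

theorem sign_union_left {I J : Finset (Fin n)} (h : Disjoint I J) (K : Finset (Fin n)) :
    D.sign (I ∪ J) K = D.sign I K * D.sign J K := Finset.prod_union h

theorem sign_union_right (I : Finset (Fin n)) {J K : Finset (Fin n)} (h : Disjoint J K) :
    D.sign I (J ∪ K) = D.sign I J * D.sign I K := by
  simp only [sign, ← Finset.prod_mul_distrib, Finset.prod_union h]

/-- The cocycle identity behind associativity. For disjoint I, J and disjoint J, K both sides are
the product of the three pairwise signs; otherwise both vanish. -/
theorem sign_assoc (I J K : Finset (Fin n)) :
    D.sign I J * D.sign (I ∪ J) K = D.sign J K * D.sign I (J ∪ K) := by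
  by_cases h : Disjoint I J
  · by_cases h' : Disjoint J K
    · rw [sign_union_left _ h, sign_union_right _ _ h']
      ring
    · rw [sign_union_left _ h, D.sign_eq_zero_iff.2 h']
      ring
  · by_cases h' : Disjoint J K
    · rw [sign_union_right _ _ h', D.sign_eq_zero_iff.2 h]
      ring
    · rw [D.sign_eq_zero_iff.2 h, D.sign_eq_zero_iff.2 h']
      ring

theorem sign_singleton_left (k : Fin n) (J : Finset (Fin n)) :
    D.sign {k} J = (-1) ^ J.card * ((∏ j ∈ J, D.coeff j k) * D.sign J {k}) := by
  simp only [sign, Finset.prod_singleton, D.swap_comm k, Finset.prod_mul_distrib,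
    Finset.prod_neg, neg_mul]

/-! ### The algebra of forms -/

/-- Differential forms: a family of coefficients `a_I`, which stands for `∑ du_I a_I`. -/
def Form (_ : TwistedPartials 𝕜 A n) : Type v := Finset (Fin n) → A

namespace Form

instance : AddCommGroup D.Form := inferInstanceAs (AddCommGroup (Finset (Fin n) → A))

instance : Module 𝕜 D.Form := inferInstanceAs (Module 𝕜 (Finset (Fin n) → A))

/-- The form `du_I a`. -/
def single (I : Finset (Fin n)) : A →ₗ[𝕜] D.Form :=
  LinearMap.single 𝕜 (fun _ : Finset (Fin n) => A) I

/-- The coefficient of `du_I`. -/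
def coord (I : Finset (Fin n)) : D.Form →ₗ[𝕜] A :=
  LinearMap.proj (φ := fun _ : Finset (Fin n) => A) I

variable {D}

theorem coord_single (I J : Finset (Fin n)) (a : A) :
    coord D J (single D I a) = if J = I then a else 0 := by
  change Pi.single (M := fun _ => A) I a J = _
  rw [Pi.single_apply]

theorem ext_coord {f g : D.Form} (h : ∀ I, coord D I f = coord D I g) : f = g := funext h

theorem sum_single (f : D.Form) : ∑ I, single D I (coord D I f) = f :=
  Finset.univ_sum_single (M := fun _ : Finset (Fin n) => A) f

/-- Coefficients stand on the right, so a has to cross du_J, which applies the automorphisms indexed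
by J to it. -/
instance : Mul D.Form where
  mul f g := ∑ I, ∑ J, single D (I ∪ J)
    (D.sign I J • (D.autProd J (coord D I f) * coord D J g))

theorem mul_def (f g : D.Form) : f * g = ∑ I, ∑ J, single D (I ∪ J)
    (D.sign I J • (D.autProd J (coord D I f) * coord D J g)) := rfl

theorem single_mul_single (I J : Finset (Fin n)) (a b : A) :
    single D I a * single D J b = single D (I ∪ J) (D.sign I J • (D.autProd J a * b)) := by
  rw [mul_def, Finset.sum_eq_single I, Finset.sum_eq_single J]
  · simp [coord_single]
  · intro K _ hK
    simp [coord_single, hK]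
  · simp
  · intro K _ hK
    simp [coord_single, hK]
  · simp

instance : NonUnitalNonAssocRing D.Form where
  left_distrib f g h := by
    simp only [mul_def, map_add, mul_add, smul_add, Finset.sum_add_distrib]
  right_distrib f g h := by
    simp only [mul_def, map_add, add_mul, smul_add, Finset.sum_add_distrib]
  zero_mul f := by simp [mul_def]
  mul_zero f := by simp [mul_def]

theorem single_mul_assoc (I J K : Finset (Fin n)) (a b c : A) :
    single D I a * single D J b * single D K c = single D I a * (single D J b * single D K c) := by
  simp only [single_mul_single, Finset.union_assoc]
  congr 1
  simp only [map_smul, map_mul, smul_mul_assoc, mul_smul_comm, smul_smul]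
  -- The automorphism of J ∪ K factors only when J and K are disjoint; otherwise the signs kill both
  -- sides.
  by_cases h : Disjoint J K
  · rw [Finset.union_comm J K, autProd_union _ h.symm, Finset.union_comm K J, mul_assoc,
      mul_comm (D.sign _ K), sign_assoc, mul_comm]
  · rw [mul_comm, sign_assoc, D.sign_eq_zero_iff.2 h]
    simp

instance : Ring D.Form where
  __ := (inferInstance : NonUnitalNonAssocRing D.Form)
  mul_assoc f g h := by
    rw [← sum_single f, ← sum_single g, ← sum_single h]
    simp only [Finset.sum_mul, Finset.mul_sum, single_mul_assoc]
  one := single D ∅ 1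
  one_mul f := by
    change single D ∅ 1 * f = f
    rw [← sum_single f]
    simp only [Finset.mul_sum, single_mul_single]
    simp [sign_empty_left]
  mul_one f := by
    change f * single D ∅ 1 = f
    rw [← sum_single f]
    simp only [Finset.sum_mul, single_mul_single]
    simp [sign_empty_right, autProd_empty]

theorem one_def : (1 : D.Form) = single D ∅ 1 := rfl

instance : Algebra 𝕜 D.Form := Algebra.ofModule
  (fun r f g => by
    simp only [mul_def, map_smul, smul_mul_assoc, smul_comm r (D.sign _ _), Finset.smul_sum])
  (fun r f g => by
    simp only [mul_def, map_smul, mul_smul_comm, smul_comm r (D.sign _ _), Finset.smul_sum])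

end Form

/-- The basis form `du_I`. -/
def basisForm (I : Finset (Fin n)) : D.Form := Form.single D I 1

/-- The inclusion of `A` as the forms of degree zero. -/
def toForm : A →ₐ[𝕜] D.Form :=
  AlgHom.ofLinearMap (Form.single D ∅) rfl fun a b => by
    simp [Form.single_mul_single, sign_empty_left, autProd_empty]

open Form

theorem toForm_apply (a : A) : D.toForm a = single D ∅ a := rfl

theorem basisForm_mul_toForm (I : Finset (Fin n)) (a : A) :
    D.basisForm I * D.toForm a = single D I a := by
  simp [basisForm, toForm_apply, single_mul_single, sign_empty_right, autProd_empty]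

theorem toForm_mul_basisForm (I : Finset (Fin n)) (a : A) :
    D.toForm a * D.basisForm I = D.basisForm I * D.toForm (D.autProd I a) := by
  rw [basisForm_mul_toForm]
  simp [basisForm, toForm_apply, single_mul_single, sign_empty_left]

theorem basisForm_mul_basisForm (I J : Finset (Fin n)) :
    D.basisForm I * D.basisForm J = D.sign I J • D.basisForm (I ∪ J) := by
  simp [basisForm, single_mul_single]

/-! ### The differential -/

/-- The differential on `A`, with values in one-forms. -/
def grad : A →ₗ[𝕜] D.Form := ∑ j, single D {j} ∘ₗ D.der j

theorem grad_apply (a : A) : D.grad a = ∑ j, D.basisForm {j} * D.toForm (D.der j a) := by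
  simp [grad, basisForm_mul_toForm]

theorem grad_mul (a b : A) :
    D.grad (a * b) = D.grad a * D.toForm b + D.toForm a * D.grad b := by
  simp only [grad_apply, der_mul, Finset.sum_mul, Finset.mul_sum, ← Finset.sum_add_distrib]
  refine Finset.sum_congr rfl fun j _ => ?_
  rw [← mul_assoc (D.toForm a), toForm_mul_basisForm, autProd_singleton, map_add, map_mul, map_mul,
    mul_add, mul_assoc, mul_assoc, add_comm]

/-- Moving duₖ across du_J costs (-1)^|J| times the product of the `coeff j k`, and moving ∂ₖ across
the automorphism of J costs the same product. This is why one matrix `coeff` governs both rules. -/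
theorem grad_mul_basisForm (a : A) (J : Finset (Fin n)) :
    D.grad a * D.basisForm J =
      (-1 : 𝕜) ^ J.card • (D.basisForm J * D.grad (D.autProd J a)) := by
  simp only [grad_apply, Finset.sum_mul, Finset.mul_sum, Finset.smul_sum]
  refine Finset.sum_congr rfl fun k _ => ?_
  rw [mul_assoc, toForm_mul_basisForm, ← mul_assoc, ← mul_assoc, basisForm_mul_basisForm,
    basisForm_mul_basisForm, der_autProd, sign_singleton_left, Finset.union_comm, map_smul]
  simp only [smul_mul_assoc, mul_smul_comm, smul_smul]

/-- The differential on forms: `d(du_I a) = (-1)^|I| du_I ∧ da`. -/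
def diff : D.Form →ₗ[𝕜] D.Form :=
  ∑ I : Finset (Fin n), (-1 : 𝕜) ^ I.card • 
    (LinearMap.mulLeft 𝕜 (D.basisForm I) ∘ₗ D.grad ∘ₗ coord D I)

theorem diff_basisForm_mul_toForm (I : Finset (Fin n)) (a : A) :
    D.diff (D.basisForm I * D.toForm a) = (-1 : 𝕜) ^ I.card • (D.basisForm I * D.grad a) := by
  rw [basisForm_mul_toForm, diff, LinearMap.sum_apply, Finset.sum_eq_single I]
  · simp [coord_single]
  · intro J _ hJ
    simp [coord_single, hJ]
  · simp

theorem diff_toForm (a : A) : D.diff (D.toForm a) = D.grad a := by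
  have h := D.diff_basisForm_mul_toForm ∅ a
  have h1 : D.basisForm ∅ = 1 := rfl
  simpa [h1] using h

theorem sum_basisForm (f : D.Form) : ∑ I, D.basisForm I * D.toForm (coord D I f) = f := by
  simp only [basisForm_mul_toForm, sum_single]

theorem diff_basisForm_mul (I : Finset (Fin n)) (f : D.Form) :
    D.diff (D.basisForm I * f) = (-1 : 𝕜) ^ I.card • (D.basisForm I * D.diff f) := by
  rw [← D.sum_basisForm f]
  simp only [Finset.mul_sum, map_sum, Finset.smul_sum]
  refine Finset.sum_congr rfl fun J _ => ?_
  rw [← mul_assoc, basisForm_mul_basisForm, smul_mul_assoc, map_smul, diff_basisForm_mul_toForm,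
    diff_basisForm_mul_toForm]
  by_cases h : Disjoint I J
  · rw [Finset.card_union_of_disjoint h, mul_smul_comm, ← mul_assoc, basisForm_mul_basisForm,
      smul_mul_assoc]
    simp only [smul_smul]
    congr 1
    ring
  · rw [D.sign_eq_zero_iff.2 h, mul_smul_comm, ← mul_assoc, basisForm_mul_basisForm,
      D.sign_eq_zero_iff.2 h]
    simp

/-- In the double sum the terms (j, k) and (k, j) cancel: the twisted symmetry of the second
derivatives is inverse to that of duⱼ ∧ duₖ, up to the sign. The diagonal terms have coefficient
zero. -/
theorem diff_grad (a : A) : D.diff (D.grad a) = 0 := by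
  rw [grad_apply, map_sum]
  have h : ∀ j, D.diff (D.basisForm {j} * D.toForm (D.der j a)) =
      -∑ k, D.swap j k • single D ({j} ∪ {k}) (D.der k (D.der j a)) := fun j => by
    rw [diff_basisForm_mul_toForm, grad_apply, Finset.mul_sum, Finset.card_singleton,
      pow_one, neg_one_smul]
    simp only [← mul_assoc, basisForm_mul_basisForm, smul_mul_assoc, sign_singleton]
    simp only [basisForm_mul_toForm]
  simp only [h, Finset.sum_neg_distrib, neg_eq_zero, ← Finset.sum_product']
  refine Finset.sum_involution (fun p _ => (p.2, p.1)) ?_ ?_ (by simp) (by simp)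
  · rintro ⟨j, k⟩ -
    simp only
    rw [D.der_der j k, D.swap_comm k j, Finset.union_comm {k}]
    simp [smul_smul, mul_comm]
  · rintro ⟨j, k⟩ - h1 h2
    obtain rfl : k = j := congrArg Prod.fst h2
    simp [swap] at h1

theorem diff_diff (f : D.Form) : D.diff (D.diff f) = 0 := by
  rw [← D.sum_basisForm f]
  simp only [map_sum, map_smul, diff_basisForm_mul, diff_toForm, diff_grad, mul_zero, smul_zero,
    Finset.sum_const_zero]

/-- After a is carried across du_J, this reduces to the Leibniz rule on A and to
`grad_mul_basisForm`, whose sign (-1)^|J| is the one that d acquires on passing du_J. -/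
theorem diff_mul_basisForm_mul_toForm (I J : Finset (Fin n)) (a b : A) :
    D.diff (D.basisForm I * D.toForm a * (D.basisForm J * D.toForm b)) =
      D.diff (D.basisForm I * D.toForm a) * (D.basisForm J * D.toForm b) +
        (-1 : 𝕜) ^ I.card • (D.basisForm I * D.toForm a * D.diff (D.basisForm J * D.toForm b)) := by
  have h1 : D.basisForm I * D.toForm a * (D.basisForm J * D.toForm b) =
      D.basisForm I * (D.basisForm J * D.toForm (D.autProd J a * b)) := by
    rw [map_mul, ← mul_assoc (D.basisForm J), ← toForm_mul_basisForm]
    simp only [mul_assoc]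
  rw [h1, diff_basisForm_mul, diff_basisForm_mul_toForm, diff_basisForm_mul_toForm,
    diff_basisForm_mul_toForm, grad_mul, smul_mul_assoc, ← smul_add]
  congr 1
  rw [mul_assoc (D.basisForm I), ← mul_assoc (D.grad a), grad_mul_basisForm, mul_assoc (D.basisForm I),
    mul_smul_comm, mul_smul_comm, ← mul_assoc (D.toForm a), toForm_mul_basisForm]
  simp only [smul_mul_assoc, mul_smul_comm, mul_add, mul_assoc, smul_add]

/-! ### Grading and density -/

/-- The forms of degree `m`. -/
def formsOfDegree (m : ℕ) : Submodule 𝕜 D.Form where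
  carrier := {f | ∀ I : Finset (Fin n), I.card ≠ m → coord D I f = 0}
  add_mem' hf hg I hI := by rw [map_add, hf I hI, hg I hI, add_zero]
  zero_mem' I _ := map_zero _
  smul_mem' c f hf I hI := by rw [map_smul, hf I hI, smul_zero]

theorem single_mem (I : Finset (Fin n)) (a : A) : single D I a ∈ D.formsOfDegree I.card := by
  intro J hJ
  rw [coord_single, if_neg]
  rintro rfl
  exact hJ rfl

variable {D} in
theorem single_coord_mem {m : ℕ} {f : D.Form} (hf : f ∈ D.formsOfDegree m) (I : Finset (Fin n)) :
    single D I (coord D I f) ∈ D.formsOfDegree m := by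
  by_cases h : I.card = m
  · exact h ▸ single_mem _ _ _
  · rw [hf I h, map_zero]
    exact zero_mem _

theorem formsOfDegree_eq_span (m : ℕ) : D.formsOfDegree m =
    Submodule.span 𝕜 {f | ∃ I : Finset (Fin n), I.card = m ∧ ∃ a, f = single D I a} := by
  apply le_antisymm
  · intro f hf
    rw [← sum_single f]
    refine sum_mem fun I _ => ?_
    by_cases h : I.card = m
    · exact Submodule.subset_span ⟨I, h, _, rfl⟩
    · rw [hf I h, map_zero]
      exact zero_mem _
  · rw [Submodule.span_le]
    rintro _ ⟨I, rfl, a, rfl⟩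
    exact single_mem _ _ _

theorem mul_mem_formsOfDegree {l m : ℕ} {f g : D.Form} (hf : f ∈ D.formsOfDegree l)
    (hg : g ∈ D.formsOfDegree m) : f * g ∈ D.formsOfDegree (l + m) := by
  rw [formsOfDegree_eq_span] at hf hg
  induction hf using Submodule.span_induction with
  | zero => simp
  | add f f' _ _ h h' => rw [add_mul]; exact add_mem h h'
  | smul c f _ h => rw [smul_mul_assoc]; exact Submodule.smul_mem _ _ h
  | mem f hf =>
    obtain ⟨I, rfl, a, rfl⟩ := hf
    induction hg using Submodule.span_induction with
    | zero => simp
    | add f f' _ _ h h' => rw [mul_add]; exact add_mem h h'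
    | smul c f _ h => rw [mul_smul_comm]; exact Submodule.smul_mem _ _ h
    | mem g hg =>
      obtain ⟨J, rfl, b, rfl⟩ := hg
      rw [single_mul_single]
      by_cases h : Disjoint I J
      · rw [← Finset.card_union_of_disjoint h]
        exact single_mem _ _ _
      · rw [D.sign_eq_zero_iff.2 h, zero_smul, map_zero]
        exact zero_mem _

/-- The homogeneous components of a form. -/
def decomposeForm (f : D.Form) : DirectSum ℕ fun m => D.formsOfDegree m :=
  ∑ I, DirectSum.of (fun m => D.formsOfDegree m) I.card
    ⟨single D I (coord D I f), single_mem _ _ _⟩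

instance : GradedAlgebra D.formsOfDegree where
  one_mem := single_mem D ∅ 1
  mul_mem _ _ _ _ := D.mul_mem_formsOfDegree
  decompose' := D.decomposeForm
  left_inv f := by
    rw [decomposeForm, map_sum]
    simp only [DirectSum.coeAddMonoidHom_of, sum_single]
  right_inv x := by
    induction x using DirectSum.induction_on with
    | zero =>
      rw [map_zero, decomposeForm]
      refine Finset.sum_eq_zero fun I _ => ?_
      simp only [map_zero]
      exact map_zero _
    | add x y hx hy =>
      rw [map_add]
      conv_rhs => rw [← hx, ← hy]
      simp only [decomposeForm, ← Finset.sum_add_distrib, ← map_add, AddMemClass.mk_add_mk]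
    | of m f =>
      rw [DirectSum.coeAddMonoidHom_of, decomposeForm]
      -- Summands with |I| ≠ m are zero, so all of them may be placed in the single degree m and
      -- added there.
      have h : ∀ I : Finset (Fin n), DirectSum.of (fun m => D.formsOfDegree m) I.card
          ⟨single D I (coord D I (f : D.Form)), single_mem _ _ _⟩ =
          DirectSum.of (fun m => D.formsOfDegree m) m
            ⟨single D I (coord D I (f : D.Form)), single_coord_mem f.2 I⟩ := by
        intro I
        by_cases h : I.card = m
        · subst h; rfl
        · have h0 := f.2 I h
          simp only [h0, map_zero]
          exact (map_zero _).trans (map_zero _).symm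
      simp only [h, ← map_sum]
      congr 1
      apply Subtype.ext
      simp [sum_single]

theorem toForm_mem_formsOfDegree (f : D.Form) :
    f ∈ D.formsOfDegree 0 ↔ ∃ a, D.toForm a = f := by
  constructor
  · intro hf
    refine ⟨coord D ∅ f, ext_coord fun I => ?_⟩
    rw [toForm_apply, coord_single]
    split_ifs with h
    · rw [h]
    · exact (hf I (by simpa using h)).symm
  · rintro ⟨a, rfl⟩
    exact single_mem D ∅ a

theorem grad_mem (a : A) : D.grad a ∈ D.formsOfDegree 1 := by
  rw [grad, LinearMap.sum_apply]
  exact sum_mem fun j _ => D.single_mem {j} _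

theorem diff_mem {m : ℕ} {f : D.Form} (hf : f ∈ D.formsOfDegree m) :
    D.diff f ∈ D.formsOfDegree (m + 1) := by
  rw [formsOfDegree_eq_span] at hf
  induction hf using Submodule.span_induction with
  | zero => simp
  | add f f' _ _ h h' => rw [map_add]; exact add_mem h h'
  | smul c f _ h => rw [map_smul]; exact Submodule.smul_mem _ _ h
  | mem f hf =>
    obtain ⟨I, rfl, a, rfl⟩ := hf
    rw [← basisForm_mul_toForm, diff_basisForm_mul_toForm]
    exact Submodule.smul_mem _ _ (D.mul_mem_formsOfDegree (D.single_mem I 1) (D.grad_mem a))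

theorem diff_mul {m : ℕ} {f : D.Form} (hf : f ∈ D.formsOfDegree m) (g : D.Form) :
    D.diff (f * g) = D.diff f * g + (-1) ^ m * (f * D.diff g) := by
  have h1 : ∀ x : D.Form, (-1) ^ m * x = (-1 : 𝕜) ^ m • x := fun x => by
    rcases Nat.even_or_odd m with h | h <;> simp [h.neg_one_pow]
  rw [h1]
  rw [formsOfDegree_eq_span] at hf
  induction hf using Submodule.span_induction with
  | zero => simp
  | add f f' _ _ h h' => simp only [add_mul, map_add, h, h', smul_add]; abel
  | smul c f _ h => simp only [smul_mul_assoc, map_smul, h, smul_add, smul_comm c]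
  | mem f hf =>
    obtain ⟨I, rfl, a, rfl⟩ := hf
    rw [← basisForm_mul_toForm, ← D.sum_basisForm g]
    simp only [Finset.mul_sum, map_sum, Finset.smul_sum, ← Finset.sum_add_distrib,
      diff_mul_basisForm_mul_toForm]

theorem grad_gen (i : Fin n) : D.grad (D.gen i) = D.basisForm {i} := by
  rw [grad_apply, Finset.sum_eq_single i]
  · simp [der_gen]
  · intro j _ hj
    simp [der_gen, hj.symm]
  · simp

theorem sign_eq_one {i : Fin n} {J : Finset (Fin n)} (h : ∀ j ∈ J, i < j) :
    D.sign {i} J = 1 := by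
  rw [sign, Finset.prod_singleton]
  exact Finset.prod_eq_one fun j hj => if_pos (h j hj)

theorem basisForm_eq_prod {m : ℕ} {I : Finset (Fin n)} (hI : I.card = m) :
    ∃ b : Fin m → A, D.basisForm I = (List.ofFn fun i => D.diff (D.toForm (b i))).prod := by
  induction m generalizing I with
  | zero =>
    obtain rfl := Finset.card_eq_zero.1 hI
    exact ⟨0, by simp [basisForm, one_def]⟩
  | succ m ih =>
    -- Splitting off the smallest index keeps the product in order, so no sign appears.
    have hne : I.Nonempty := Finset.card_pos.1 (by omega)
    obtain ⟨b, hb⟩ := ih (I := I.erase (I.min' hne))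
      (by rw [Finset.card_erase_of_mem (I.min'_mem hne)]; omega)
    refine ⟨Fin.cons (D.gen (I.min' hne)) b, ?_⟩
    rw [List.ofFn_succ, List.prod_cons]
    simp only [Fin.cons_zero, Fin.cons_succ]
    rw [← hb, diff_toForm, grad_gen, basisForm_mul_basisForm, sign_eq_one, one_smul,
      ← Finset.insert_eq, Finset.insert_erase (I.min'_mem hne)]
    intro j hj
    exact I.min'_lt_of_mem_erase_min' hne hj

theorem formsOfDegree_dense (m : ℕ) : D.formsOfDegree m = Submodule.span 𝕜
    {f | ∃ (a : A) (b : Fin m → A),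
      f = D.toForm a * (List.ofFn fun i => D.diff (D.toForm (b i))).prod} := by
  apply le_antisymm
  · rw [formsOfDegree_eq_span, Submodule.span_le]
    rintro _ ⟨I, hI, a, rfl⟩
    obtain ⟨b, hb⟩ := D.basisForm_eq_prod hI
    -- Density asks for coefficients on the left; moving a there undoes the automorphism of I.
    refine Submodule.subset_span ⟨(D.autProd I).symm a, b, ?_⟩
    rw [← hb, toForm_mul_basisForm, AlgEquiv.apply_symm_apply, basisForm_mul_toForm]
  · rw [Submodule.span_le]
    rintro _ ⟨a, b, rfl⟩
    have h : (List.ofFn fun i => D.diff (D.toForm (b i))).prod ∈ D.formsOfDegree m := by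
      induction m with
      | zero => simpa [one_def] using single_mem D ∅ 1
      | succ m ih =>
        rw [List.ofFn_succ, List.prod_cons, diff_toForm]
        have h := D.mul_mem_formsOfDegree (D.grad_mem (b 0)) (ih fun i => b i.succ)
        rwa [add_comm] at h
    simpa [toForm_apply] using D.mul_mem_formsOfDegree (D.single_mem ∅ a) h

/-! ### The calculus and its top-degree pairing -/

/-- The differential calculus of a system of twisted partial derivatives. -/
def calculus : DifferentialCalculus 𝕜 A where
  Form := D.Form
  degree := D.formsOfDegree
  toForm := D.toForm
  toForm_injective a b h := by
    have := congrArg (coord D ∅) h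
    simpa [toForm_apply, coord_single] using this
  degree_zero := D.toForm_mem_formsOfDegree
  d := D.diff
  d_mem := D.diff_mem
  d_d := D.diff_diff
  leibniz := D.diff_mul
  dense := D.formsOfDegree_dense

theorem calculus_hasDimension [Nontrivial A] : D.calculus.HasDimension n := by
  constructor
  · intro h
    have h1 : single D Finset.univ 1 ∈ D.formsOfDegree n := by
      simpa using D.single_mem Finset.univ 1
    have h2 : D.formsOfDegree n = ⊥ := h
    rw [h2, Submodule.mem_bot] at h1
    have h3 := congrArg (coord D Finset.univ) h1
    simp [coord_single] at h3
  · intro m hm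
    rw [eq_bot_iff]
    intro f hf
    refine ext_coord (D := D) fun I => ?_
    refine (hf I ?_).trans (map_zero _).symm
    have := I.card_le_univ
    simp only [Fintype.card_fin] at this
    omega

theorem calculus_isConnected
    (h : ∀ a : A, (∀ j, D.der j a = 0) → ∃ r : 𝕜, algebraMap 𝕜 A r = a) :
    D.calculus.IsConnected := by
  intro a
  change D.diff (D.toForm a) = 0 ↔ _
  rw [diff_toForm]
  constructor
  · intro ha
    refine h a fun j => ?_
    have h1 := congrArg (coord D {j}) ha
    rw [grad, LinearMap.sum_apply, map_sum] at h1
    simpa [coord_single] using h1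
  · rintro ⟨r, rfl⟩
    simp [grad, Algebra.algebraMap_eq_smul_one, der_one]

theorem coord_univ_mul_toForm (f : D.Form) (a : A) :
    coord D Finset.univ (f * D.toForm a) = coord D Finset.univ f * a := by
  conv_lhs => rw [← sum_single f]
  simp [Finset.sum_mul, toForm_apply, single_mul_single, sign_empty_right, autProd_empty,
    coord_single]

theorem coord_univ_toForm_mul (a : A) (f : D.Form) :
    coord D Finset.univ (D.toForm a * f) = D.autProd Finset.univ a * coord D Finset.univ f := by
  conv_lhs => rw [← sum_single f]
  simp [Finset.mul_sum, toForm_apply, single_mul_single, sign_empty_left, coord_single]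

/-- Among the sets I of size k only Jᶜ satisfies I ∪ J = univ, so the pairing is antidiagonal in the
basis du_I. -/
theorem coord_univ_mul_single {k m : ℕ} (h : k + m = n) {f : D.Form} (hf : f ∈ D.formsOfDegree k)
    {J : Finset (Fin n)} (hJ : J.card = m) (b : A) :
    coord D Finset.univ (f * single D J b) =
      D.sign Jᶜ J • (D.autProd J (coord D Jᶜ f) * b) := by
  conv_lhs => rw [← sum_single f]
  rw [Finset.sum_mul, map_sum, Finset.sum_eq_single Jᶜ]
  · rw [single_mul_single, coord_single, if_pos]
    rw [Finset.union_comm, Finset.union_compl]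
  · intro I _ hI
    rw [single_mul_single, coord_single]
    by_cases hc : I.card = k
    · rw [if_neg]
      intro hu
      apply hI
      have h1 : Jᶜ ⊆ I := by
        intro x hx
        have : x ∈ I ∪ J := hu ▸ Finset.mem_univ x
        simp only [Finset.mem_compl] at hx
        simpa [hx] using this
      refine (Finset.eq_of_subset_of_card_le h1 ?_).symm
      rw [Finset.card_compl, Fintype.card_fin]
      omega
    · rw [hf I hc]
      simp
  · simp

/-- The antidiagonal entries are nonzero scalars combined with automorphisms of A, hence invertible.
Testing against du_{Iᶜ} recovers the coefficient of du_I. -/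
theorem pairing_bijective {k m : ℕ} (h : k + m = n) : Function.Bijective
    (D.calculus.pairing (coord D Finset.univ) D.coord_univ_mul_toForm k m) := by
  have hs : ∀ J : Finset (Fin n), D.sign Jᶜ J ≠ 0 := fun J hJ =>
    D.sign_eq_zero_iff.1 hJ disjoint_compl_left
  constructor
  · rw [injective_iff_map_eq_zero]
    rintro ⟨(f : D.Form), (hf : f ∈ D.formsOfDegree k)⟩ h0
    apply Subtype.ext
    refine ext_coord (D := D) fun I => ?_
    refine Eq.trans ?_ (map_zero (coord D I)).symm
    by_cases hI : I.card = k
    · have hm : Iᶜ.card = m := by rw [Finset.card_compl, Fintype.card_fin]; omega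
      have h1 := congrArg (fun φ => φ.1 (⟨single D Iᶜ 1, hm ▸ D.single_mem Iᶜ 1⟩ :
        D.calculus.degree m)) h0
      change coord D Finset.univ (f * single D Iᶜ 1) = 0 at h1
      rw [D.coord_univ_mul_single h hf hm] at h1
      have h2 := hs Iᶜ
      rw [compl_compl] at h2
      simpa [h2] using h1
    · exact hf I hI
  · intro φ
    let e : Finset (Fin n) → A := fun J => if hJ : J.card = m then
      φ.1 (⟨single D J 1, hJ ▸ D.single_mem J 1⟩ : D.calculus.degree m) else 0
    -- The coefficients solve sign(Jᶜ, J) σ_J(f_{Jᶜ}) = φ(du_J); right linearity of φ then settles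
    -- all other arguments.
    let f : D.Form := ∑ J, single D Jᶜ ((D.autProd J).symm ((D.sign Jᶜ J)⁻¹ • e J))
    have hf : f ∈ D.formsOfDegree k := by
      refine sum_mem fun J _ => ?_
      by_cases hJ : J.card = m
      · have : Jᶜ.card = k := by rw [Finset.card_compl, Fintype.card_fin]; omega
        exact this ▸ D.single_mem _ _
      · simp [e, hJ]
    have hc : ∀ J, coord D Jᶜ f = (D.autProd J).symm ((D.sign Jᶜ J)⁻¹ • e J) := by
      intro J
      simp only [f, map_sum, coord_single]
      rw [Finset.sum_eq_single J]
      · simp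
      · intro K _ hK
        rw [if_neg]
        exact fun h => hK (compl_injective h).symm
      · simp
    refine ⟨⟨f, hf⟩, ?_⟩
    apply DifferentialCalculus.IntegralForm.ext'
    rintro ⟨(g : D.Form), (hg' : g ∈ D.formsOfDegree m)⟩
    change coord D Finset.univ (f * g) = _
    have key : ∀ J : Finset (Fin n), coord D Finset.univ (f * single D J (coord D J g)) =
        φ.1 (⟨single D J (coord D J g), single_coord_mem hg' J⟩ : D.calculus.degree m) := by
      intro J
      by_cases hJ : J.card = m
      · rw [D.coord_univ_mul_single h hf hJ, hc, AlgEquiv.apply_symm_apply, smul_mul_assoc,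
          smul_smul, mul_inv_cancel₀ (hs J), one_smul]
        simp only [e, hJ, dif_pos]
        rw [← φ.2]
        congr 1
        apply Subtype.ext
        change single D J 1 * D.toForm _ = _
        exact D.basisForm_mul_toForm _ _
      · have h0 := hg' J hJ
        simp only [h0, map_zero, mul_zero]
        exact (map_zero φ.1).symm
    have hsum : (⟨g, hg'⟩ : D.calculus.degree m) =
        ∑ J, ⟨single D J (coord D J g), single_coord_mem hg' J⟩ := by
      apply Subtype.ext
      rw [AddSubmonoidClass.coe_finsetSum]
      exact (sum_single g).symm
    rw [hsum, map_sum]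
    conv_lhs => rw [← sum_single g]
    rw [Finset.mul_sum, map_sum]
    exact Finset.sum_congr rfl fun J _ => key J

end TwistedPartials

theorem TwistedPartials.calculus_isIntegrable {𝕜 : Type u} {A : Type v} [Field 𝕜] [Ring A]
    [Algebra 𝕜 A] {n : ℕ} (D : TwistedPartials 𝕜 A (n + 2)) : D.calculus.IsIntegrable (n + 2) :=
  DifferentialCalculus.isIntegrable_of_pairing _ (D.autProd Finset.univ) D.coord_univ_mul_toForm
    D.coord_univ_toForm_mul fun _ _ h => D.pairing_bijective h

/-! ### Ordered monomials, their filtration and the universal property -/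

/-- The monomial `u₀ᵃ u₁ᵇ u₂ᶜ u₃ᵈ` for `α = (a, b, c, d)`. -/
def pbwMonomial {B : Type v} [Monoid B] (u : Fin 4 → B) (α : ℕ × ℕ × ℕ × ℕ) : B :=
  u 0 ^ α.1 * u 1 ^ α.2.1 * u 2 ^ α.2.2.1 * u 3 ^ α.2.2.2

namespace PBWScalars

variable {𝕜 : Type u} [Field 𝕜] (S : PBWScalars 𝕜)

/-- The defining relations for a family `u = (t₁, t₂, x₁, x₂)` in an algebra. -/
structure Commutation {B : Type v} [Ring B] [Algebra 𝕜 B] (u : Fin 4 → B) : Prop where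
  t2_t1 : u 1 * u 0 = u 0 * u 1
  x1_t1 : u 2 * u 0 = S.a111 • (u 0 * u 2) + S.b11 • u 2 + S.p1 • 1
  x2_t1 : u 3 * u 0 = S.a211 • (u 0 * u 3) + S.b21 • u 3 + S.p2 • 1
  x1_t2 : u 2 * u 1 = S.a122 • (u 1 * u 2) + S.b12 • u 2 + S.p1 • 1
  x2_t2 : u 3 * u 1 = S.a222 • (u 1 * u 3) + S.b22 • u 3 + S.p2 • 1
  x2_x1 : u 3 * u 2 = S.c • (u 2 * u 3) + S.q0 • 1 + S.q1 • u 2 + S.q2 • u 3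

end PBWScalars

section Filtration

variable (𝕜 : Type u) [Field 𝕜] {B : Type v} [Ring B] [Algebra 𝕜 B]

/-- The span of the monomials of total degree at most `N`. -/
def pbwFiltration (u : Fin 4 → B) (N : ℕ) : Submodule 𝕜 B :=
  Submodule.span 𝕜 (pbwMonomial u '' {α | α.1 + α.2.1 + α.2.2.1 + α.2.2.2 ≤ N})

variable {𝕜}

theorem pbwMonomial_mem {u : Fin 4 → B} {a b c d N : ℕ} (h : a + b + c + d ≤ N) :
    pbwMonomial u (a, b, c, d) ∈ pbwFiltration 𝕜 u N :=
  Submodule.subset_span ⟨(a, b, c, d), h, rfl⟩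

theorem pbwFiltration_mono (u : Fin 4 → B) {M N : ℕ} (h : M ≤ N) :
    pbwFiltration 𝕜 u M ≤ pbwFiltration 𝕜 u N :=
  Submodule.span_mono (Set.image_mono fun _ hα => le_trans hα h)

theorem mul_mem_pbwFiltration {u : Fin 4 → B} {y : B}
    (h : ∀ a b c d, y * pbwMonomial u (a, b, c, d) ∈ pbwFiltration 𝕜 u (a + b + c + d + 1))
    {N : ℕ} {z : B} (hz : z ∈ pbwFiltration 𝕜 u N) : y * z ∈ pbwFiltration 𝕜 u (N + 1) := by
  have : pbwFiltration 𝕜 u N ≤ (pbwFiltration 𝕜 u (N + 1)).comap (LinearMap.mulLeft 𝕜 y) := by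
    refine Submodule.span_le.2 ?_
    rintro _ ⟨⟨a, b, c, d⟩, hα, rfl⟩
    exact pbwFiltration_mono u (Nat.succ_le_succ hα) (h a b c d)
  exact this hz

variable {S : PBWScalars 𝕜} {u : Fin 4 → B}

theorem pbwMonomial_succ_t1 (u : Fin 4 → B) (a b c d : ℕ) :
    pbwMonomial u (a + 1, b, c, d) = u 0 * pbwMonomial u (a, b, c, d) := by
  simp only [pbwMonomial, pow_succ', mul_assoc]

theorem pbwMonomial_succ_t2 (u : Fin 4 → B) (b c d : ℕ) :
    pbwMonomial u (0, b + 1, c, d) = u 1 * pbwMonomial u (0, b, c, d) := by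
  simp only [pbwMonomial, pow_succ', pow_zero, one_mul, mul_assoc]

theorem pbwMonomial_succ_x1 (u : Fin 4 → B) (c d : ℕ) :
    pbwMonomial u (0, 0, c + 1, d) = u 2 * pbwMonomial u (0, 0, c, d) := by
  simp only [pbwMonomial, pow_succ', pow_zero, one_mul, mul_assoc]

theorem pbwMonomial_succ_x2 (u : Fin 4 → B) (d : ℕ) :
    pbwMonomial u (0, 0, 0, d + 1) = u 3 * pbwMonomial u (0, 0, 0, d) := by
  simp only [pbwMonomial, pow_succ', pow_zero, one_mul]

namespace PBWScalars.Commutation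

theorem t1_mul_mem {N : ℕ} {z : B} (hz : z ∈ pbwFiltration 𝕜 u N) :
    u 0 * z ∈ pbwFiltration 𝕜 u (N + 1) :=
  mul_mem_pbwFiltration (fun a b c d => by
    rw [← pbwMonomial_succ_t1]
    exact pbwMonomial_mem (by omega)) hz

theorem t2_mul_mem (h : S.Commutation u) {N : ℕ} {z : B} (hz : z ∈ pbwFiltration 𝕜 u N) :
    u 1 * z ∈ pbwFiltration 𝕜 u (N + 1) :=
  mul_mem_pbwFiltration (fun a b c d => by
    have h1 : u 1 * pbwMonomial u (a, b, c, d) = pbwMonomial u (a, b + 1, c, d) := by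
      have h2 : u 1 * u 0 ^ a = u 0 ^ a * u 1 := (Commute.pow_right h.t2_t1 a :)
      simp only [pbwMonomial, pow_succ', ← mul_assoc, h2]
    rw [h1]
    exact pbwMonomial_mem (by omega)) hz

/-- An element that almost commutes with `t₁` and `t₂` multiplies the filtration into the next
step if it does so on the monomials in `x₁` and `x₂`. -/
theorem mul_mem_of_affine (h : S.Commutation u) {y : B} {a₁ b₁ a₂ b₂ p : 𝕜}
    (h1 : y * u 0 = a₁ • (u 0 * y) + b₁ • y + p • 1)
    (h2 : y * u 1 = a₂ • (u 1 * y) + b₂ • y + p • 1)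
    (h3 : ∀ c d, y * pbwMonomial u (0, 0, c, d) ∈ pbwFiltration 𝕜 u (c + d + 1))
    {N : ℕ} {z : B} (hz : z ∈ pbwFiltration 𝕜 u N) : y * z ∈ pbwFiltration 𝕜 u (N + 1) := by
  refine mul_mem_pbwFiltration (fun a b c d => ?_) hz
  induction a with
  | zero =>
    induction b with
    | zero => simpa using h3 c d
    | succ b ih =>
      rw [pbwMonomial_succ_t2, ← mul_assoc, h2, add_mul, add_mul, smul_mul_assoc, smul_mul_assoc,
        smul_mul_assoc, one_mul, mul_assoc]
      refine add_mem (add_mem (Submodule.smul_mem _ _ ?_) (Submodule.smul_mem _ _ ?_))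
        (Submodule.smul_mem _ _ (pbwMonomial_mem (by omega)))
      · exact pbwFiltration_mono u (by omega) (h.t2_mul_mem ih)
      · exact pbwFiltration_mono u (by omega) ih
  | succ a ih =>
    rw [pbwMonomial_succ_t1, ← mul_assoc, h1, add_mul, add_mul, smul_mul_assoc, smul_mul_assoc,
      smul_mul_assoc, one_mul, mul_assoc]
    refine add_mem (add_mem (Submodule.smul_mem _ _ ?_) (Submodule.smul_mem _ _ ?_))
      (Submodule.smul_mem _ _ (pbwMonomial_mem (by omega)))
    · exact pbwFiltration_mono u (by omega) (t1_mul_mem ih)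
    · exact pbwFiltration_mono u (by omega) ih

theorem x1_mul_mem (h : S.Commutation u) {N : ℕ} {z : B} (hz : z ∈ pbwFiltration 𝕜 u N) :
    u 2 * z ∈ pbwFiltration 𝕜 u (N + 1) :=
  h.mul_mem_of_affine h.x1_t1 h.x1_t2 (fun c d => by
    rw [← pbwMonomial_succ_x1]
    exact pbwMonomial_mem (by omega)) hz

/-- Once the powers of t₁ and t₂ are dealt with, induction on the exponent of x₁: each term of the
relation for x₂x₁ either leaves x₂ in front of a shorter monomial or contains no x₂ to move. -/
theorem x2_mul_mem (h : S.Commutation u) {N : ℕ} {z : B} (hz : z ∈ pbwFiltration 𝕜 u N) :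
    u 3 * z ∈ pbwFiltration 𝕜 u (N + 1) := by
  refine h.mul_mem_of_affine h.x2_t1 h.x2_t2 (fun c d => ?_) hz
  induction c with
  | zero =>
    rw [← pbwMonomial_succ_x2]
    exact pbwMonomial_mem (by omega)
  | succ c ih =>
    have hm : pbwMonomial u (0, 0, c, d) ∈ pbwFiltration 𝕜 u (c + d) :=
      pbwMonomial_mem (by omega)
    rw [pbwMonomial_succ_x1, ← mul_assoc, h.x2_x1, add_mul, add_mul, add_mul, smul_mul_assoc,
      smul_mul_assoc, smul_mul_assoc, smul_mul_assoc, one_mul, mul_assoc]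
    refine add_mem (add_mem (add_mem (Submodule.smul_mem _ _ ?_) (Submodule.smul_mem _ _ ?_))
      (Submodule.smul_mem _ _ ?_)) (Submodule.smul_mem _ _ ?_)
    · exact pbwFiltration_mono u (by omega) (h.x1_mul_mem ih)
    · exact pbwFiltration_mono u (by omega) hm
    · exact pbwFiltration_mono u (by omega) (h.x1_mul_mem hm)
    · exact pbwFiltration_mono u (by omega) ih

theorem gen_mul_mem (h : S.Commutation u) (i : Fin 4) {N : ℕ} {z : B}
    (hz : z ∈ pbwFiltration 𝕜 u N) : u i * z ∈ pbwFiltration 𝕜 u (N + 1) := by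
  fin_cases i
  exacts [t1_mul_mem hz, h.t2_mul_mem hz, h.x1_mul_mem hz, h.x2_mul_mem hz]

/-- The span of all monomials is closed under multiplication. -/
theorem mul_mem_span (h : S.Commutation u) {y z : B}
    (hy : y ∈ Submodule.span 𝕜 (Set.range (pbwMonomial u)))
    (hz : z ∈ Submodule.span 𝕜 (Set.range (pbwMonomial u))) :
    y * z ∈ Submodule.span 𝕜 (Set.range (pbwMonomial u)) := by
  have hgen : ∀ i, ∀ z ∈ Submodule.span 𝕜 (Set.range (pbwMonomial u)),
      u i * z ∈ Submodule.span 𝕜 (Set.range (pbwMonomial u)) := by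
    intro i z hz
    induction hz using Submodule.span_induction with
    | zero => simp
    | add f g _ _ hf hg => rw [mul_add]; exact add_mem hf hg
    | smul c f _ hf => rw [mul_smul_comm]; exact Submodule.smul_mem _ _ hf
    | mem f hf =>
      obtain ⟨⟨a, b, c, d⟩, rfl⟩ := hf
      exact Submodule.span_mono (Set.image_subset_range _ _)
        (h.gen_mul_mem i (pbwMonomial_mem (le_refl (a + b + c + d))))
  have hpow : ∀ i m, ∀ z ∈ Submodule.span 𝕜 (Set.range (pbwMonomial u)),
      u i ^ m * z ∈ Submodule.span 𝕜 (Set.range (pbwMonomial u)) := by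
    intro i m z hz
    induction m with
    | zero => simpa using hz
    | succ m ih =>
      rw [pow_succ', mul_assoc]
      exact hgen i _ ih
  induction hy using Submodule.span_induction with
  | zero => simp
  | add f g _ _ hf hg => rw [add_mul]; exact add_mem hf hg
  | smul c f _ hf => rw [smul_mul_assoc]; exact Submodule.smul_mem _ _ hf
  | mem f hf =>
    obtain ⟨⟨a, b, c, d⟩, rfl⟩ := hf
    simp only [pbwMonomial, mul_assoc]
    exact hpow _ _ _ (hpow _ _ _ (hpow _ _ _ (hpow _ _ _ hz)))

theorem prod {B' : Type w} [Ring B'] [Algebra 𝕜 B'] {u' : Fin 4 → B'} (h : S.Commutation u)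
    (h' : S.Commutation u') : S.Commutation fun i => (u i, u' i) where
  t2_t1 := Prod.ext h.t2_t1 h'.t2_t1
  x1_t1 := Prod.ext h.x1_t1 h'.x1_t1
  x2_t1 := Prod.ext h.x2_t1 h'.x2_t1
  x1_t2 := Prod.ext h.x1_t2 h'.x1_t2
  x2_t2 := Prod.ext h.x2_t2 h'.x2_t2
  x2_x1 := Prod.ext h.x2_x1 h'.x2_x1

/-- Universal property without a rewriting argument. The pairs (xᵢ, uᵢ) in A × B again satisfy the
relations, so the span of their monomials is closed under products. This span is the graph of the
linear map matching monomials, which is therefore multiplicative. -/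
theorem exists_algHom {A : Type w} [Ring A] [Algebra 𝕜 A] {x : Fin 4 → A} (hx : S.Commutation x)
    (b : Module.Basis (ℕ × ℕ × ℕ × ℕ) 𝕜 A) (hb : ∀ α, b α = pbwMonomial x α)
    (hu : S.Commutation u) : ∃ φ : A →ₐ[𝕜] B, ∀ i, φ (x i) = u i := by
  let L : A →ₗ[𝕜] B := b.constr 𝕜 (pbwMonomial u)
  have hL : ∀ α, L (pbwMonomial x α) = pbwMonomial u α := fun α => by
    rw [← hb, Module.Basis.constr_basis]
  have hgen : ∀ i, L (x i) = u i := by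
    intro i
    fin_cases i
    · simpa [pbwMonomial] using hL (1, 0, 0, 0)
    · simpa [pbwMonomial] using hL (0, 1, 0, 0)
    · simpa [pbwMonomial] using hL (0, 0, 1, 0)
    · simpa [pbwMonomial] using hL (0, 0, 0, 1)
  have hpair : ∀ α, pbwMonomial (fun i => (x i, u i)) α = (pbwMonomial x α, pbwMonomial u α) :=
    fun α => rfl
  have hgraph : ∀ z ∈ Submodule.span 𝕜 (Set.range (pbwMonomial fun i => (x i, u i))),
      z.2 = L z.1 := by
    have : Submodule.span 𝕜 (Set.range (pbwMonomial fun i => (x i, u i))) ≤ L.graph := by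
      refine Submodule.span_le.2 ?_
      rintro _ ⟨α, rfl⟩
      rw [hpair]
      exact (hL α).symm
    exact fun z hz => this hz
  have hmem : ∀ a : A, (a, L a) ∈
      Submodule.span 𝕜 (Set.range (pbwMonomial fun i => (x i, u i))) := by
    have : (⊤ : Submodule 𝕜 A) ≤
        (Submodule.span 𝕜 (Set.range (pbwMonomial fun i => (x i, u i)))).comap
          (LinearMap.prod LinearMap.id L) := by
      rw [← b.span_eq]
      refine Submodule.span_le.2 ?_
      rintro _ ⟨α, rfl⟩
      refine Submodule.subset_span ⟨α, ?_⟩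
      rw [hpair, hb, ← hL]
      rfl
    exact fun a => this (Submodule.mem_top (x := a))
  refine ⟨AlgHom.ofLinearMap L ?_ ?_, hgen⟩
  · simpa [pbwMonomial] using hL (0, 0, 0, 0)
  · intro y z
    exact (hgraph _ ((hx.prod hu).mul_mem_span (hmem y) (hmem z))).symm

end PBWScalars.Commutation

end Filtration

/-! ### The monomial basis over the ground field -/

theorem IsSkewPBWExtension.exists_basis {𝕜 : Type u} [Field 𝕜] {A : Type v} [Ring A] [Algebra 𝕜 A]
    (ι : MvPolynomial (Fin 2) 𝕜 →ₐ[𝕜] A) (x : Fin 2 → A)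
    (hA : IsSkewPBWExtension (ι : MvPolynomial (Fin 2) 𝕜 →+* A) x) :
    ∃ b : Module.Basis (ℕ × ℕ × ℕ × ℕ) 𝕜 A,
      ∀ α, b α = pbwMonomial ![ι (.X 0), ι (.X 1), x 0, x 1] α := by
  let Φ : ((Fin 2 → ℕ) →₀ MvPolynomial (Fin 2) 𝕜) →ₗ[𝕜] A :=
    Finsupp.lsum 𝕜 fun α => LinearMap.mulRight 𝕜 (standardMonomial x α) ∘ₗ ι.toLinearMap
  have hΦ : ∀ f, Φ f = f.sum fun α r => ι r * standardMonomial x α := fun f => rfl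
  have hbij : Function.Bijective Φ := by
    constructor
    · intro f g hfg
      exact (hA.basis (Φ f)).unique (hΦ f) (hfg.trans (hΦ g))
    · intro a
      obtain ⟨f, hf, -⟩ := hA.basis a
      exact ⟨f, hf.symm⟩
  -- The module basis lists the exponents of the x's first and then those of the t's; the monomials
  -- are written the other way round.
  let e : (Σ _ : Fin 2 → ℕ, Fin 2 →₀ ℕ) ≃ ℕ × ℕ × ℕ × ℕ :=
    { toFun := fun s => (s.2 0, s.2 1, s.1 0, s.1 1)
      invFun := fun α => ⟨![α.2.2.1, α.2.2.2], Finsupp.equivFunOnFinite.symm ![α.1, α.2.1]⟩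
      left_inv := by
        rintro ⟨s, m⟩
        simp only [Sigma.mk.injEq, heq_eq_eq]
        constructor
        · ext i; fin_cases i <;> rfl
        · ext i; fin_cases i <;> rfl
      right_inv := fun α => rfl }
  refine ⟨((Finsupp.basis fun _ : Fin 2 → ℕ => MvPolynomial.basisMonomials (Fin 2) 𝕜).map
    (LinearEquiv.ofBijective Φ hbij)).reindex e, ?_⟩
  rintro ⟨a, b, c, d⟩
  rw [Module.Basis.reindex_apply, Module.Basis.map_apply, Finsupp.coe_basis]
  change Φ (Finsupp.single ![c, d] (MvPolynomial.basisMonomials (Fin 2) 𝕜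
    (Finsupp.equivFunOnFinite.symm ![a, b]))) = _
  rw [hΦ, Finsupp.sum_single_index (by simp), MvPolynomial.coe_basisMonomials]
  beta_reduce
  rw [MvPolynomial.monomial_eq, Finsupp.prod_fintype _ _ (by simp)]
  simp [standardMonomial, pbwMonomial, Fin.prod_univ_two, List.ofFn_succ, mul_assoc]

/-! ### Growth exponents of quartically bounded sequences -/

section GrowthRate

open Filter Topology

theorem tendsto_add_div_log (r : ℝ) :
    Tendsto (fun n : ℕ => ((4 + r / Real.log n : ℝ) : EReal)) atTop (𝓝 ((4 : ℝ) : EReal)) := by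
  refine (continuous_coe_real_ereal.tendsto _).comp ?_
  have h : Tendsto (fun n : ℕ => r / Real.log n) atTop (𝓝 0) :=
    (Real.tendsto_log_atTop.comp tendsto_natCast_atTop_atTop).const_div_atTop r
  simpa using h.const_add 4

/-- A sequence bounded by a quartic polynomial has growth exponent at most four. -/
theorem limsup_log_div_log_le {f : ℕ → ℕ} {M : ℕ} (h : ∀ n, f n ≤ (M * n + 1) ^ 4) :
    limsup (fun n : ℕ => ((Real.log (f n) / Real.log n : ℝ) : EReal)) atTop ≤ ((4 : ℝ) : EReal) := by
  rw [← (tendsto_add_div_log (4 * Real.log (M + 1))).limsup_eq]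
  refine limsup_le_limsup ?_
  filter_upwards [eventually_ge_atTop 2] with n hn
  rw [EReal.coe_le_coe_iff]
  have hn' : (1 : ℝ) < n := by exact_mod_cast hn
  have hlog : 0 < Real.log n := Real.log_pos hn'
  have hM : (0 : ℝ) < M + 1 := by positivity
  have key : Real.log (f n) ≤ 4 * (Real.log (M + 1) + Real.log n) := by
    rw [← Real.log_mul hM.ne' (by positivity)]
    -- At f n = 0 the logarithm is 0 by convention, and the bound is still nonnegative.
    rcases Nat.eq_zero_or_pos (f n) with h0 | h0
    · rw [h0, Nat.cast_zero, Real.log_zero]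
      refine mul_nonneg (by norm_num) (Real.log_nonneg ?_)
      nlinarith [(Nat.cast_nonneg M : (0 : ℝ) ≤ M)]
    · have h1 : (4 : ℝ) * Real.log ((M + 1) * n) = Real.log (((M + 1) * n) ^ 4) := by
        rw [Real.log_pow]; norm_num
      rw [h1]
      refine Real.log_le_log (by exact_mod_cast h0) ?_
      have h2 : f n ≤ ((M + 1) * n) ^ 4 :=
        (h n).trans (Nat.pow_le_pow_left (by nlinarith) 4)
      exact_mod_cast h2
  rw [div_le_iff₀ hlog, add_mul, div_mul_cancel₀ _ hlog.ne']
  linarith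

/-- A sequence bounded below by a quartic polynomial has growth exponent at least four. -/
theorem le_limsup_log_div_log {f : ℕ → ℕ} (h : ∀ n, (n / 4 + 1) ^ 4 ≤ f n) :
    ((4 : ℝ) : EReal) ≤ limsup (fun n : ℕ => ((Real.log (f n) / Real.log n : ℝ) : EReal)) atTop := by
  rw [← (tendsto_add_div_log (-(4 * Real.log 4))).limsup_eq]
  refine limsup_le_limsup ?_
  filter_upwards [eventually_ge_atTop 2] with n hn
  rw [EReal.coe_le_coe_iff]
  have hn' : (1 : ℝ) < n := by exact_mod_cast hn
  have hlog : 0 < Real.log n := Real.log_pos hn'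
  have key : 4 * (Real.log n - Real.log 4) ≤ Real.log (f n) := by
    rw [← Real.log_div (by positivity) (by norm_num)]
    have h1 : (4 : ℝ) * Real.log (n / 4) = Real.log ((n / 4) ^ 4) := by
      rw [Real.log_pow]; norm_num
    rw [h1]
    refine Real.log_le_log (by positivity) ?_
    have h2 : (n : ℝ) / 4 ≤ ((n / 4 + 1 : ℕ) : ℝ) := by
      rw [div_le_iff₀ (by norm_num)]
      exact_mod_cast (by omega : n ≤ (n / 4 + 1) * 4)
    calc ((n : ℝ) / 4) ^ 4 ≤ ((n / 4 + 1 : ℕ) : ℝ) ^ 4 := by gcongr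
      _ ≤ (f n : ℝ) := by exact_mod_cast h n
  rw [le_div_iff₀ hlog, add_mul, div_mul_cancel₀ _ hlog.ne']
  linarith

end GrowthRate

/-! ### Gelfand–Kirillov dimension and affine endomorphisms -/

section GelfandKirillov

variable {𝕜 : Type u} [Field 𝕜] {A : Type v} [Ring A] [Algebra 𝕜 A] {S : PBWScalars 𝕜}
  {u : Fin 4 → A}

theorem pbwFiltration_le_span_box (u : Fin 4 → A) (N : ℕ) : pbwFiltration 𝕜 u N ≤
    Submodule.span 𝕜 (Set.range fun k : Fin (N + 1) × Fin (N + 1) × Fin (N + 1) × Fin (N + 1) =>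
      pbwMonomial u (k.1, k.2.1, k.2.2.1, k.2.2.2)) := by
  refine Submodule.span_mono ?_
  rintro _ ⟨⟨a, b, c, d⟩, h, rfl⟩
  simp only [Set.mem_ofPred_eq] at h
  exact ⟨(⟨a, by omega⟩, ⟨b, by omega⟩, ⟨c, by omega⟩, ⟨d, by omega⟩), rfl⟩

instance (u : Fin 4 → A) (N : ℕ) : FiniteDimensional 𝕜 (pbwFiltration 𝕜 u N) :=
  have := FiniteDimensional.span_of_finite 𝕜 (Set.finite_range
    fun k : Fin (N + 1) × Fin (N + 1) × Fin (N + 1) × Fin (N + 1) =>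
      pbwMonomial u (k.1, k.2.1, k.2.2.1, k.2.2.2))
  Submodule.finiteDimensional_of_le (pbwFiltration_le_span_box u N)

theorem finrank_pbwFiltration_le (u : Fin 4 → A) (N : ℕ) :
    Module.finrank 𝕜 (pbwFiltration 𝕜 u N) ≤ (N + 1) ^ 4 := by
  have := FiniteDimensional.span_of_finite 𝕜 (Set.finite_range
    fun k : Fin (N + 1) × Fin (N + 1) × Fin (N + 1) × Fin (N + 1) =>
      pbwMonomial u (k.1, k.2.1, k.2.2.1, k.2.2.2))
  refine (Submodule.finrank_mono (pbwFiltration_le_span_box u N)).trans ?_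
  refine (finrank_range_le_card _).trans_eq ?_
  simp only [Fintype.card_prod, Fintype.card_fin]
  ring

/-- Four exponents, each at most N / 4, have sum at most N, so the filtration step contains a full
box of basis monomials. -/
theorem le_finrank_pbwFiltration (b : Module.Basis (ℕ × ℕ × ℕ × ℕ) 𝕜 A)
    (hb : ∀ α, b α = pbwMonomial u α) (N : ℕ) :
    (N / 4 + 1) ^ 4 ≤ Module.finrank 𝕜 (pbwFiltration 𝕜 u N) := by
  let g : Fin (N / 4 + 1) × Fin (N / 4 + 1) × Fin (N / 4 + 1) × Fin (N / 4 + 1) →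
    ℕ × ℕ × ℕ × ℕ := fun k => (k.1, k.2.1, k.2.2.1, k.2.2.2)
  have hg : Function.Injective g := by
    rintro ⟨k1, k2, k3, k4⟩ ⟨l1, l2, l3, l4⟩ h
    simpa [g, Fin.ext_iff] using h
  have hli : LinearIndependent 𝕜 (b ∘ g) := b.linearIndependent.comp g hg
  have hcard := finrank_span_eq_card hli
  have hle : Submodule.span 𝕜 (Set.range (b ∘ g)) ≤ pbwFiltration 𝕜 u N := by
    refine Submodule.span_le.2 ?_
    rintro _ ⟨⟨k1, k2, k3, k4⟩, rfl⟩
    rw [Function.comp_apply, hb]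
    exact pbwMonomial_mem (by omega)
  have := Submodule.finrank_mono hle
  rw [hcard] at this
  simp only [Fintype.card_prod, Fintype.card_fin] at this
  calc (N / 4 + 1) ^ 4 = _ := by ring
    _ ≤ _ := this

namespace PBWScalars.Commutation

theorem pow_mul_mem (h : S.Commutation u) (i : Fin 4) (m : ℕ) {N : ℕ} {z : A}
    (hz : z ∈ pbwFiltration 𝕜 u N) : u i ^ m * z ∈ pbwFiltration 𝕜 u (m + N) := by
  induction m with
  | zero => simpa using hz
  | succ m ih =>
    rw [pow_succ', mul_assoc]
    exact pbwFiltration_mono u (by omega) (h.gen_mul_mem i ih)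

theorem pbwFiltration_mul_le (h : S.Commutation u) (M N : ℕ) :
    pbwFiltration 𝕜 u M * pbwFiltration 𝕜 u N ≤ pbwFiltration 𝕜 u (M + N) := by
  refine Submodule.mul_le.2 fun y hy z hz => ?_
  induction hy using Submodule.span_induction with
  | zero => simp
  | add f g _ _ hf hg => rw [add_mul]; exact add_mem hf hg
  | smul c f _ hf => rw [smul_mul_assoc]; exact Submodule.smul_mem _ _ hf
  | mem f hf =>
    obtain ⟨⟨a, b, c, d⟩, hα, rfl⟩ := hf
    simp only [Set.mem_ofPred_eq] at hα
    simp only [pbwMonomial, mul_assoc]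
    exact pbwFiltration_mono u (by omega) (h.pow_mul_mem 0 a (h.pow_mul_mem 1 b
      (h.pow_mul_mem 2 c (h.pow_mul_mem 3 d hz))))

end PBWScalars.Commutation

theorem one_mem_pbwFiltration (u : Fin 4 → A) (N : ℕ) : (1 : A) ∈ pbwFiltration 𝕜 u N := by
  simpa [pbwMonomial] using pbwMonomial_mem (𝕜 := 𝕜) (u := u) (a := 0) (b := 0) (c := 0) (d := 0)
    (Nat.zero_le N)

theorem gen_mem_pbwFiltration (u : Fin 4 → A) (i : Fin 4) : u i ∈ pbwFiltration 𝕜 u 1 := by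
  fin_cases i
  · simpa [pbwMonomial] using pbwMonomial_mem (𝕜 := 𝕜) (u := u) (show 1 + 0 + 0 + 0 ≤ 1 by simp)
  · simpa [pbwMonomial] using pbwMonomial_mem (𝕜 := 𝕜) (u := u) (show 0 + 1 + 0 + 0 ≤ 1 by simp)
  · simpa [pbwMonomial] using pbwMonomial_mem (𝕜 := 𝕜) (u := u) (show 0 + 0 + 1 + 0 ≤ 1 by simp)
  · simpa [pbwMonomial] using pbwMonomial_mem (𝕜 := 𝕜) (u := u) (show 0 + 0 + 0 + 1 ≤ 1 by simp)

namespace PBWScalars.Commutation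

theorem pow_le_pbwFiltration (h : S.Commutation u) {V : Submodule 𝕜 A} {M : ℕ}
    (hV : V ≤ pbwFiltration 𝕜 u M) (n : ℕ) : V ^ n ≤ pbwFiltration 𝕜 u (M * n) := by
  induction n with
  | zero =>
    rw [pow_zero, Submodule.one_le]
    exact one_mem_pbwFiltration u _
  | succ n ih =>
    rw [pow_succ, mul_add, mul_one]
    exact (mul_le_mul' ih hV).trans (h.pbwFiltration_mul_le _ _)

/-- A monomial of degree m is a product of m generators. The powers of this one finite-dimensional
subspace thus realise the quartic growth, which gives the lower bound for the dimension. -/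
theorem pbwFiltration_one_pow (h : S.Commutation u) (n : ℕ) :
    pbwFiltration 𝕜 u 1 ^ n = pbwFiltration 𝕜 u n := by
  apply le_antisymm
  · simpa using h.pow_le_pbwFiltration (le_refl (pbwFiltration 𝕜 u 1)) n
  · refine Submodule.span_le.2 ?_
    rintro _ ⟨⟨a, b, c, d⟩, hα, rfl⟩
    simp only [Set.mem_ofPred_eq] at hα
    have h1 : (1 : Submodule 𝕜 A) ≤ pbwFiltration 𝕜 u 1 :=
      Submodule.one_le.2 (one_mem_pbwFiltration u 1)
    refine pow_le_pow_right' h1 hα ?_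
    rw [pow_add, pow_add, pow_add]
    have hp : ∀ i m, u i ^ m ∈ pbwFiltration 𝕜 u 1 ^ m := fun i m =>
      Submodule.pow_mem_pow _ (gen_mem_pbwFiltration u i) m
    exact Submodule.mul_mem_mul (Submodule.mul_mem_mul (Submodule.mul_mem_mul (hp 0 a) (hp 1 b))
      (hp 2 c)) (hp 3 d)

end PBWScalars.Commutation

theorem exists_mem_pbwFiltration (b : Module.Basis (ℕ × ℕ × ℕ × ℕ) 𝕜 A)
    (hb : ∀ α, b α = pbwMonomial u α) (y : A) : ∃ N, y ∈ pbwFiltration 𝕜 u N := by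
  have hy : y ∈ Submodule.span 𝕜 (Set.range b) := b.mem_span y
  induction hy using Submodule.span_induction with
  | zero => exact ⟨0, zero_mem _⟩
  | add f g _ _ hf hg =>
    obtain ⟨M, hM⟩ := hf
    obtain ⟨N, hN⟩ := hg
    exact ⟨max M N, add_mem (pbwFiltration_mono u (le_max_left _ _) hM)
      (pbwFiltration_mono u (le_max_right _ _) hN)⟩
  | smul c f _ hf =>
    obtain ⟨M, hM⟩ := hf
    exact ⟨M, Submodule.smul_mem _ _ hM⟩
  | mem f hf =>
    obtain ⟨⟨a, b', c, d⟩, rfl⟩ := hf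
    rw [hb]
    exact ⟨_, pbwMonomial_mem le_rfl⟩

theorem exists_le_pbwFiltration (b : Module.Basis (ℕ × ℕ × ℕ × ℕ) 𝕜 A)
    (hb : ∀ α, b α = pbwMonomial u α) (V : Submodule 𝕜 A) [FiniteDimensional 𝕜 V] :
    ∃ N, V ≤ pbwFiltration 𝕜 u N := by
  obtain ⟨s, hs⟩ : V.FG := Module.Finite.iff_fg.1 inferInstance
  choose N hN using exists_mem_pbwFiltration b hb
  refine ⟨s.sup N, ?_⟩
  rw [← hs, Submodule.span_le]
  exact fun y hy => pbwFiltration_mono u (Finset.le_sup hy) (hN y)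

theorem PBWScalars.Commutation.gelfandKirillovDim_eq (h : S.Commutation u)
    (b : Module.Basis (ℕ × ℕ × ℕ × ℕ) 𝕜 A) (hb : ∀ α, b α = pbwMonomial u α) :
    gelfandKirillovDim 𝕜 A = ((4 : ℝ) : EReal) := by
  apply le_antisymm
  · refine iSup_le fun V => iSup_le fun hV => iSup_le fun _ => ?_
    obtain ⟨M, hM⟩ := exists_le_pbwFiltration b hb V
    refine limsup_log_div_log_le (M := M) fun n => ?_
    exact (Submodule.finrank_mono (h.pow_le_pbwFiltration hM n)).trans
      (finrank_pbwFiltration_le u _)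
  · refine le_trans ?_ (le_iSup_of_le (pbwFiltration 𝕜 u 1) (le_iSup_of_le inferInstance
      (le_iSup_of_le (one_mem_pbwFiltration u 1) le_rfl)))
    refine le_limsup_log_div_log fun n => ?_
    rw [h.pbwFiltration_one_pow]
    exact le_finrank_pbwFiltration b hb n

theorem adjoin_range_eq_top (b : Module.Basis (ℕ × ℕ × ℕ × ℕ) 𝕜 A)
    (hb : ∀ α, b α = pbwMonomial u α) : Algebra.adjoin 𝕜 (Set.range u) = ⊤ := by
  rw [eq_top_iff]
  intro y _
  have hu : ∀ i m, u i ^ m ∈ Algebra.adjoin 𝕜 (Set.range u) := fun i m =>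
    pow_mem (Algebra.subset_adjoin (Set.mem_range_self i)) m
  have : Submodule.span 𝕜 (Set.range b) ≤
      Subalgebra.toSubmodule (Algebra.adjoin 𝕜 (Set.range u)) := by
    refine Submodule.span_le.2 ?_
    rintro _ ⟨α, rfl⟩
    rw [hb]
    change _ ∈ Algebra.adjoin 𝕜 (Set.range u)
    exact mul_mem (mul_mem (mul_mem (hu _ _) (hu _ _)) (hu _ _)) (hu _ _)
  exact this (b.mem_span y)

theorem pbwFiltration_one_le {W : Submodule 𝕜 A} (h1 : (1 : A) ∈ W) (hu : ∀ i, u i ∈ W) :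
    pbwFiltration 𝕜 u 1 ≤ W := by
  refine Submodule.span_le.2 ?_
  rintro _ ⟨⟨a, b, c, d⟩, hα, rfl⟩
  simp only [Set.mem_ofPred_eq] at hα
  have hcases : (a, b, c, d) = (0, 0, 0, 0) ∨ (a, b, c, d) = (1, 0, 0, 0) ∨
      (a, b, c, d) = (0, 1, 0, 0) ∨ (a, b, c, d) = (0, 0, 1, 0) ∨ (a, b, c, d) = (0, 0, 0, 1) := by
    simp only [Prod.mk.injEq]
    omega
  rcases hcases with h | h | h | h | h <;> rw [h] <;> simp [pbwMonomial, h1, hu]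

/-- An algebra endomorphism that is affine and diagonal on the generators is bijective. -/
theorem PBWScalars.Commutation.bijective_of_affine (h : S.Commutation u)
    (b : Module.Basis (ℕ × ℕ × ℕ × ℕ) 𝕜 A) (hb : ∀ α, b α = pbwMonomial u α) (φ : A →ₐ[𝕜] A)
    {r s : Fin 4 → 𝕜} (hr : ∀ i, r i ≠ 0) (hφ : ∀ i, φ (u i) = r i • u i + s i • 1) :
    Function.Bijective φ := by
  -- The affine substitution can be inverted on the span of 1 and the generators. As the filtration
  -- consists of powers of this span, every step is mapped onto itself.
  have hmap1 : (pbwFiltration 𝕜 u 1).map φ.toLinearMap = pbwFiltration 𝕜 u 1 := by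
    apply le_antisymm
    · rw [Submodule.map_le_iff_le_comap]
      refine pbwFiltration_one_le ?_ fun i => ?_
      · simpa using one_mem_pbwFiltration u 1
      · rw [Submodule.mem_comap, AlgHom.toLinearMap_apply, hφ]
        exact add_mem (Submodule.smul_mem _ _ (gen_mem_pbwFiltration u i))
          (Submodule.smul_mem _ _ (one_mem_pbwFiltration u 1))
    · have h1 : (1 : A) ∈ (pbwFiltration 𝕜 u 1).map φ.toLinearMap :=
        ⟨1, one_mem_pbwFiltration u 1, map_one φ⟩
      refine pbwFiltration_one_le h1 fun i => ?_
      have h2 : u i = (r i)⁻¹ • (φ (u i) - s i • 1) := by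
        rw [hφ, add_sub_cancel_right, smul_smul, inv_mul_cancel₀ (hr i), one_smul]
      rw [h2]
      exact Submodule.smul_mem _ _ (sub_mem ⟨u i, gen_mem_pbwFiltration u i, rfl⟩
        (Submodule.smul_mem _ _ h1))
  have hmap : ∀ N, (pbwFiltration 𝕜 u N).map φ.toLinearMap = pbwFiltration 𝕜 u N := fun N => by
    rw [← h.pbwFiltration_one_pow, Submodule.map_pow, hmap1]
  constructor
  · rw [injective_iff_map_eq_zero]
    intro y hy
    obtain ⟨N, hN⟩ := exists_mem_pbwFiltration b hb y
    -- On a finite-dimensional step, surjectivity implies injectivity.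
    let ψ : pbwFiltration 𝕜 u N →ₗ[𝕜] pbwFiltration 𝕜 u N :=
      φ.toLinearMap.restrict fun z hz => hmap N ▸ Submodule.mem_map_of_mem hz
    have hψ : Function.Surjective ψ := by
      rintro ⟨z, hz⟩
      rw [← hmap N] at hz
      obtain ⟨w, hw, rfl⟩ := hz
      exact ⟨⟨w, hw⟩, rfl⟩
    have h0 : ψ ⟨y, hN⟩ = ψ 0 := by
      rw [map_zero]
      exact Subtype.ext hy
    exact congrArg Subtype.val (LinearMap.injective_iff_surjective.2 hψ h0)
  · intro y
    obtain ⟨N, hN⟩ := exists_mem_pbwFiltration b hb y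
    rw [← hmap N] at hN
    obtain ⟨w, -, rfl⟩ := hN
    exact ⟨w, rfl⟩

end GelfandKirillov

/-! ### Scalar identities forced by the basis and by the cases -/

namespace PBWScalars

variable {𝕜 : Type u} [Field 𝕜] {S : PBWScalars 𝕜}

/-- This identity says that x₁ ↦ x₁, x₂ ↦ c x₂ + q₁ preserves the constant term of the relation for
x₂x₁. The overlaps used below do not supply it, since none involves only x₁ and x₂. -/
theorem IsAdmissible.c_sub_one_mul_q0 (h : S.IsAdmissible) : (S.c - 1) * S.q0 = S.q1 * S.q2 := by
  rcases h with h | h | h | h | h | h | h | h | h | h | h | h | h | h | h | h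
  · obtain ⟨-, -, -, -, h⟩ := h
    grind
  · grind [CaseB]
  · grind [CaseC]
  · grind [CaseD]
  · grind [CaseE]
  · grind [CaseF]
  · grind [CaseG]
  · grind [CaseH]
  · grind [CaseI]
  · grind [CaseJ]
  · grind [CaseK]
  · grind [CaseL]
  · grind [CaseM]
  · grind [CaseN]
  · grind [CaseO]
  · grind [CaseP]

section Overlaps

variable {A : Type v} [Ring A] [Algebra 𝕜 A]

/-- The two ways of rewriting `y t₁ t₂` agree. -/
theorem overlap_ytt {t t' y : A} {a a' b b' p : 𝕜} (ht : t' * t = t * t')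
    (hy : y * t = a • (t * y) + b • y + p • 1) (hy' : y * t' = a' • (t' * y) + b' • y + p • 1) :
    (p * (b - b')) • 1 + (p * (1 - a')) • t' + (p * (a - 1)) • t = 0 := by
  have e1 : y * t * t' = (a * a') • (t * (t' * y)) + (a * b') • (t * y) + (a * p) • t +
      (b * a') • (t' * y) + (b * b') • y + (b * p) • 1 + p • t' := by
    simp only [hy, hy', add_mul, mul_add, smul_mul_assoc, mul_smul_comm, mul_assoc, one_mul,
      mul_one]
    module
  have e2 : y * t' * t = (a' * a) • (t * (t' * y)) + (a' * b) • (t' * y) + (a' * p) • t' +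
      (b' * a) • (t * y) + (b' * b) • y + (b' * p) • 1 + p • t := by
    simp only [hy, hy', add_mul, mul_add, smul_mul_assoc, mul_smul_comm, mul_assoc, one_mul,
      mul_one]
    rw [← mul_assoc t' t, ht, mul_assoc]
    module
  have e3 : y * t * t' = y * t' * t := by rw [mul_assoc, ← ht, mul_assoc]
  rw [e1, e2, ← sub_eq_zero] at e3
  rw [← e3]
  module

/-- The two ways of rewriting `y x t` agree. -/
theorem overlap_yxt {t x y : A} {a₁ a₂ b₁ b₂ p₁ p₂ c q₀ q₁ q₂ : 𝕜}
    (hx : x * t = a₁ • (t * x) + b₁ • x + p₁ • 1) (hy : y * t = a₂ • (t * y) + b₂ • y + p₂ • 1)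
    (hyx : y * x = c • (x * y) + q₀ • 1 + q₁ • x + q₂ • y) :
    (q₀ * (a₁ * b₂ + b₁) - q₁ * p₁ - q₂ * p₂) • 1 + (q₀ * (a₁ * a₂ - 1)) • t +
      ((a₁ * b₂ + b₁) * q₁ + a₁ * p₂ - c * p₂ - q₁ * b₁) • x +
      ((a₁ * b₂ + b₁) * q₂ + p₁ - c * a₂ * p₁ - q₂ * b₂) • y +
      (q₁ * a₁ * (a₂ - 1)) • (t * x) + (q₂ * a₂ * (a₁ - 1)) • (t * y) +
      (c * (a₁ * b₂ + b₁ - a₂ * b₁ - b₂)) • (x * y) = 0 := by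
  have e1 : y * (x * t) = (a₁ * a₂) • (t * (y * x)) + (a₁ * b₂ + b₁) • (y * x) +
      (a₁ * p₂) • x + p₁ • y := by
    rw [hx]
    simp only [mul_add, mul_smul_comm, mul_one]
    rw [← mul_assoc y t, hy]
    simp only [add_mul, smul_mul_assoc, one_mul, mul_assoc]
    module
  have e2 : x * (y * t) = (a₂ * a₁) • (t * (x * y)) + (a₂ * b₁ + b₂) • (x * y) +
      (a₂ * p₁) • y + p₂ • x := by
    rw [hy]
    simp only [mul_add, mul_smul_comm, mul_one]
    rw [← mul_assoc x t, hx]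
    simp only [add_mul, smul_mul_assoc, one_mul, mul_assoc]
    module
  have e3 : y * x * t = c • (x * (y * t)) + q₀ • t + q₁ • (x * t) + q₂ • (y * t) := by
    rw [hyx]
    simp only [add_mul, smul_mul_assoc, one_mul, mul_assoc]
  rw [e2, hx, hy, mul_assoc, e1, hyx] at e3
  simp only [mul_add, mul_smul_comm, mul_one] at e3
  rw [← sub_eq_zero] at e3
  rw [← e3]
  module

end Overlaps

/-- The consequences of the overlaps `y t₁ t₂` and `x₂ x₁ t` for the scalars. -/
structure Consistent (S : PBWScalars 𝕜) : Prop where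
  p1_a111 : S.p1 * (S.a111 - 1) = 0
  p1_a122 : S.p1 * (S.a122 - 1) = 0
  p2_a211 : S.p2 * (S.a211 - 1) = 0
  p2_a222 : S.p2 * (S.a222 - 1) = 0
  one₁ : S.q0 * (S.a111 * S.b21 + S.b11) = S.q1 * S.p1 + S.q2 * S.p2
  t₁ : S.q0 * (S.a111 * S.a211 - 1) = 0
  x1₁ : S.q1 * (S.a111 * S.b21) = (S.c - S.a111) * S.p2
  x2₁ : S.q2 * (S.a211 * S.b11) = (S.c * S.a211 - 1) * S.p1
  tx1₁ : S.q1 * (S.a211 - 1) = 0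
  tx2₁ : S.q2 * (S.a111 - 1) = 0
  x1x2₁ : S.a111 * S.b21 + S.b11 = S.a211 * S.b11 + S.b21
  one₂ : S.q0 * (S.a122 * S.b22 + S.b12) = S.q1 * S.p1 + S.q2 * S.p2
  t₂ : S.q0 * (S.a122 * S.a222 - 1) = 0
  x1₂ : S.q1 * (S.a122 * S.b22) = (S.c - S.a122) * S.p2
  x2₂ : S.q2 * (S.a222 * S.b12) = (S.c * S.a222 - 1) * S.p1
  tx1₂ : S.q1 * (S.a222 - 1) = 0
  tx2₂ : S.q2 * (S.a122 - 1) = 0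
  x1x2₂ : S.a122 * S.b22 + S.b12 = S.a222 * S.b12 + S.b22

/-- The scalars `aᵢⱼⱼ` and `c` are nonzero. -/
structure Nondegenerate (S : PBWScalars 𝕜) : Prop where
  a111_ne : S.a111 ≠ 0
  a122_ne : S.a122 ≠ 0
  a211_ne : S.a211 ≠ 0
  a222_ne : S.a222 ≠ 0
  c_ne : S.c ≠ 0

variable {A : Type v} [Ring A] [Algebra 𝕜 A] {u : Fin 4 → A}

/-- The overlap identities are linear relations between distinct ordered monomials, so each
coefficient vanishes separately. -/
theorem Commutation.consistent (h : S.Commutation u) (hn : S.Nondegenerate)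
    (b : Module.Basis (ℕ × ℕ × ℕ × ℕ) 𝕜 A) (hb : ∀ α, b α = pbwMonomial u α) : S.Consistent := by
  have hcoord : ∀ {y : A}, y = 0 → ∀ α, b.coord α y = 0 := fun hy α => by rw [hy, map_zero]
  have h1 : (1 : A) = b (0, 0, 0, 0) := by simp [hb, pbwMonomial]
  have h10 : u 0 = b (1, 0, 0, 0) := by simp [hb, pbwMonomial]
  have h11 : u 1 = b (0, 1, 0, 0) := by simp [hb, pbwMonomial]
  have h12 : u 2 = b (0, 0, 1, 0) := by simp [hb, pbwMonomial]
  have h13 : u 3 = b (0, 0, 0, 1) := by simp [hb, pbwMonomial]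
  have h02 : u 0 * u 2 = b (1, 0, 1, 0) := by simp [hb, pbwMonomial]
  have h03 : u 0 * u 3 = b (1, 0, 0, 1) := by simp [hb, pbwMonomial]
  have h12' : u 1 * u 2 = b (0, 1, 1, 0) := by simp [hb, pbwMonomial]
  have h13' : u 1 * u 3 = b (0, 1, 0, 1) := by simp [hb, pbwMonomial]
  have h23 : u 2 * u 3 = b (0, 0, 1, 1) := by simp [hb, pbwMonomial]
  have o1 := overlap_ytt h.t2_t1 h.x1_t1 h.x1_t2
  have o2 := overlap_ytt h.t2_t1 h.x2_t1 h.x2_t2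
  have o3 := overlap_yxt h.x1_t1 h.x2_t1 h.x2_x1
  have o4 := overlap_yxt h.x1_t2 h.x2_t2 h.x2_x1
  rw [h02, h03, h23, h1, h10, h12, h13] at o3
  rw [h12', h13', h23, h1, h11, h12, h13] at o4
  rw [h1, h10, h11] at o1 o2
  have o1t := hcoord o1 (1, 0, 0, 0)
  have o1t' := hcoord o1 (0, 1, 0, 0)
  have o2t := hcoord o2 (1, 0, 0, 0)
  have o2t' := hcoord o2 (0, 1, 0, 0)
  have o3' := fun α => hcoord o3 α
  have o4' := fun α => hcoord o4 α
  have p0 := o3' (0, 0, 0, 0)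
  have p1 := o3' (1, 0, 0, 0)
  have p2 := o3' (0, 0, 1, 0)
  have p3 := o3' (0, 0, 0, 1)
  have p4 := o3' (1, 0, 1, 0)
  have p5 := o3' (1, 0, 0, 1)
  have p6 := o3' (0, 0, 1, 1)
  have r0 := o4' (0, 0, 0, 0)
  have r1 := o4' (0, 1, 0, 0)
  have r2 := o4' (0, 0, 1, 0)
  have r3 := o4' (0, 0, 0, 1)
  have r4 := o4' (0, 1, 1, 0)
  have r5 := o4' (0, 1, 0, 1)
  have r6 := o4' (0, 0, 1, 1)
  clear o3' o4' o1 o2 o3 o4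
  simp only [map_add, map_smul, Module.Basis.coord_apply, Module.Basis.repr_self,
    Finsupp.single_apply, Prod.mk.injEq, smul_eq_mul, one_ne_zero, zero_ne_one, and_true, and_false,
    if_true, if_false, mul_one, mul_zero, add_zero, zero_add,
    and_self] at *
  obtain ⟨n1, n2, n3, n4, n5⟩ := hn
  -- The coordinates at quadratic monomials carry extra factors among c and the aᵢⱼⱼ, which are
  -- nonzero and can be cancelled.
  simp only [mul_eq_zero, n1, n2, n3, n4, n5, false_or, or_false] at p4 p5 p6 r4 r5 r6
  constructor <;> first | assumption | grind

theorem Relations.commutation {ι : MvPolynomial (Fin 2) 𝕜 →ₐ[𝕜] A} {x : Fin 2 → A}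
    (h : S.Relations ι x) : S.Commutation ![ι (.X 0), ι (.X 1), x 0, x 1] where
  t2_t1 := by
    change ι _ * ι _ = ι _ * ι _
    rw [← map_mul, ← map_mul, mul_comm]
  x1_t1 := h.x1_t1.trans (by rw [Algebra.algebraMap_eq_smul_one]; rfl)
  x2_t1 := h.x2_t1.trans (by rw [Algebra.algebraMap_eq_smul_one]; rfl)
  x1_t2 := h.x1_t2.trans (by rw [Algebra.algebraMap_eq_smul_one]; rfl)
  x2_t2 := h.x2_t2.trans (by rw [Algebra.algebraMap_eq_smul_one]; rfl)
  x2_x1 := h.x2_x1.trans (by rw [Algebra.algebraMap_eq_smul_one]; rfl)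

theorem Relations.nondegenerate {ι : MvPolynomial (Fin 2) 𝕜 →ₐ[𝕜] A} {x : Fin 2 → A}
    (h : S.Relations ι x) : S.Nondegenerate :=
  ⟨h.a111_ne, h.a122_ne, h.a211_ne, h.a222_ne, h.c_ne⟩

/-! ### Automorphisms and twisted derivations of the algebra -/

/-- The linear coefficients of the automorphisms of the calculus. -/
def autCoeff (S : PBWScalars 𝕜) : Fin 4 → Fin 4 → 𝕜 :=
  ![![1, 1, S.a111, S.a211], ![1, 1, S.a122, S.a222], ![S.a111⁻¹, S.a122⁻¹, 1, S.c],
    ![S.a211⁻¹, S.a222⁻¹, S.c⁻¹, 1]]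

/-- The constant terms of the automorphisms of the calculus. -/
def autShift (S : PBWScalars 𝕜) : Fin 4 → Fin 4 → 𝕜 :=
  ![![0, 0, 0, 0], ![0, 0, 0, 0], ![-(S.a111⁻¹ * S.b11), -(S.a122⁻¹ * S.b12), 0, S.q1],
    ![-(S.a211⁻¹ * S.b21), -(S.a222⁻¹ * S.b22), -(S.c⁻¹ * S.q2), 0]]

/-- The family of images of the generators under the automorphisms of the calculus. -/
def autGen (S : PBWScalars 𝕜) (u : Fin 4 → A) (j i : Fin 4) : A :=
  S.autCoeff j i • u i + S.autShift j i • 1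

/-- The hypotheses compare coefficients after each relation is expanded in ordered monomials. For
`h02`, `h02'`, `h02''` the monomials are u₂, u₀ and 1, with the same pattern for the other pairs
involving t₁ or t₂; for `h23`, `h23'`, `h23''` they are 1, u₂ and u₃. The quadratic terms agree
automatically. -/
theorem Commutation.affine (h : S.Commutation u) {r s : Fin 4 → 𝕜}
    (h02 : s 0 * r 2 * S.a111 + r 2 * S.b11 = r 2 * r 0 * S.b11 + r 2 * s 0)
    (h02' : r 0 * s 2 * (S.a111 - 1) = 0)
    (h02'' : r 2 * r 0 * S.p1 + s 2 * s 0 = S.a111 * (s 0 * s 2) + S.b11 * s 2 + S.p1)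
    (h03 : s 0 * r 3 * S.a211 + r 3 * S.b21 = r 3 * r 0 * S.b21 + r 3 * s 0)
    (h03' : r 0 * s 3 * (S.a211 - 1) = 0)
    (h03'' : r 3 * r 0 * S.p2 + s 3 * s 0 = S.a211 * (s 0 * s 3) + S.b21 * s 3 + S.p2)
    (h12 : s 1 * r 2 * S.a122 + r 2 * S.b12 = r 2 * r 1 * S.b12 + r 2 * s 1)
    (h12' : r 1 * s 2 * (S.a122 - 1) = 0)
    (h12'' : r 2 * r 1 * S.p1 + s 2 * s 1 = S.a122 * (s 1 * s 2) + S.b12 * s 2 + S.p1)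
    (h13 : s 1 * r 3 * S.a222 + r 3 * S.b22 = r 3 * r 1 * S.b22 + r 3 * s 1)
    (h13' : r 1 * s 3 * (S.a222 - 1) = 0)
    (h13'' : r 3 * r 1 * S.p2 + s 3 * s 1 = S.a222 * (s 1 * s 3) + S.b22 * s 3 + S.p2)
    (h23 : r 3 * r 2 * S.q0 + s 3 * s 2 = S.c * (s 2 * s 3) + S.q0 + S.q1 * s 2 + S.q2 * s 3)
    (h23' : r 3 * r 2 * S.q1 + s 3 * r 2 = S.c * (r 2 * s 3) + S.q1 * r 2)
    (h23'' : r 3 * r 2 * S.q2 + r 3 * s 2 = S.c * (s 2 * r 3) + S.q2 * r 3) :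
    S.Commutation fun i => r i • u i + s i • 1 := by
  constructor <;>
    simp only [mul_add, add_mul, smul_mul_assoc, mul_smul_comm, mul_one, one_mul, h.t2_t1, h.x1_t1,
      h.x2_t1, h.x1_t2, h.x2_t2, h.x2_x1] <;>
    match_scalars <;> first | ring1 | linear_combination h02 | linear_combination h03 |
      linear_combination h12 | linear_combination h13 | grind

/-- The family `autGen S u j` satisfies the relations. -/
theorem Commutation.affine_autGen (h : S.Commutation u) (hn : S.Nondegenerate) (hc : S.Consistent)
    (hq : (S.c - 1) * S.q0 = S.q1 * S.q2) (j : Fin 4) : S.Commutation (S.autGen u j) := by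
  obtain ⟨n1, n2, n3, n4, n5⟩ := hn
  obtain ⟨c1, c2, c3, c4, c5, c6, c7, c8, c9, c10, c11, c12, c13, c14, c15, c16, c17, c18⟩ := hc
  fin_cases j <;> refine h.affine ?_ ?_ ?_ ?_ ?_ ?_ ?_ ?_ ?_ ?_ ?_ ?_ ?_ ?_ ?_ <;>
    simp [autCoeff, autShift] <;> grind

/-- The relations make a twisted derivation with prescribed values on the generators. -/
theorem Commutation.exists_twisted_derivation {v d : Fin 4 → A} (h : S.Commutation u)
    (b : Module.Basis (ℕ × ℕ × ℕ × ℕ) 𝕜 A) (hb : ∀ α, b α = pbwMonomial u α)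
    (hv : S.Commutation v)
    (h01 : v 1 * d 0 + d 1 * u 0 = v 0 * d 1 + d 0 * u 1)
    (h20 : v 2 * d 0 + d 2 * u 0 = S.a111 • (v 0 * d 2 + d 0 * u 2) + S.b11 • d 2)
    (h30 : v 3 * d 0 + d 3 * u 0 = S.a211 • (v 0 * d 3 + d 0 * u 3) + S.b21 • d 3)
    (h21 : v 2 * d 1 + d 2 * u 1 = S.a122 • (v 1 * d 2 + d 1 * u 2) + S.b12 • d 2)
    (h31 : v 3 * d 1 + d 3 * u 1 = S.a222 • (v 1 * d 3 + d 1 * u 3) + S.b22 • d 3)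
    (h32 : v 3 * d 2 + d 3 * u 2 =
      S.c • (v 2 * d 3 + d 2 * u 3) + S.q1 • d 2 + S.q2 • d 3) :
    ∃ (σ : A →ₐ[𝕜] A) (δ : A →ₗ[𝕜] A), (∀ y z, δ (y * z) = σ y * δ z + δ y * z) ∧
      (∀ i, σ (u i) = v i) ∧ ∀ i, δ (u i) = d i := by
  -- The top right entry of a product of such matrices is v d' + d u', the twisted Leibniz rule, so
  -- a homomorphism to these matrices encodes σ and δ together.
  have hM : S.Commutation fun i => !![v i, d i; 0, u i] := by
    constructor <;> ext i j <;> fin_cases i <;> fin_cases j <;>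
      simp [Matrix.mul_apply, Fin.sum_univ_two, h01, h20, h30, h21, h31, h32, h.t2_t1, h.x1_t1,
        h.x2_t1, h.x1_t2, h.x2_t2, h.x2_x1, hv.t2_t1, hv.x1_t1, hv.x2_t1, hv.x1_t2, hv.x2_t2,
        hv.x2_x1]
  obtain ⟨φ, hφ⟩ := h.exists_algHom b hb hM
  -- The bottom row is (0, y) on generators, and this property passes to sums and products.
  have hlow : ∀ y, φ y 1 0 = 0 ∧ φ y 1 1 = y := by
    intro y
    have hy : y ∈ Algebra.adjoin 𝕜 (Set.range u) := adjoin_range_eq_top b hb ▸ Algebra.mem_top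
    induction hy using Algebra.adjoin_induction with
    | mem y hy =>
      obtain ⟨i, rfl⟩ := hy
      simp [hφ]
    | algebraMap r => simp [Matrix.algebraMap_matrix_apply]
    | add y z _ _ hy hz => simp [hy, hz]
    | mul y z _ _ hy hz => simp [Matrix.mul_apply, Fin.sum_univ_two, hy, hz]
  let σ : A →ₐ[𝕜] A := AlgHom.ofLinearMap
    (Matrix.entryLinearMap 𝕜 A 0 0 ∘ₗ φ.toLinearMap) (by simp) fun y z => by
      simp [Matrix.mul_apply, Fin.sum_univ_two, hlow]
  refine ⟨σ, Matrix.entryLinearMap 𝕜 A 0 1 ∘ₗ φ.toLinearMap, fun y z => ?_, fun i => ?_,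
    fun i => ?_⟩
  · simp [σ, Matrix.mul_apply, Fin.sum_univ_two, hlow]
  · simp [σ, hφ]
  · simp [hφ]

/-- For the values 1 at uⱼ and 0 at the other generators, the mixed conditions on v and d become
exactly the formulas that define `autGen`. With j = 0 they read v₂ = a₁₁₁u₂, and with j = 2 they
read u₀ = a₁₁₁v₀ + b₁₁. -/
theorem Commutation.exists_partial (h : S.Commutation u) (hn : S.Nondegenerate)
    (hc : S.Consistent) (hq : (S.c - 1) * S.q0 = S.q1 * S.q2)
    (b : Module.Basis (ℕ × ℕ × ℕ × ℕ) 𝕜 A) (hb : ∀ α, b α = pbwMonomial u α) (j : Fin 4) :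
    ∃ (σ : A ≃ₐ[𝕜] A) (δ : A →ₗ[𝕜] A), (∀ y z, δ (y * z) = σ y * δ z + δ y * z) ∧
      (∀ i, σ (u i) = S.autGen u j i) ∧ ∀ i, δ (u i) = if i = j then 1 else 0 := by
  have hex : ∃ (σ : A →ₐ[𝕜] A) (δ : A →ₗ[𝕜] A), (∀ y z, δ (y * z) = σ y * δ z + δ y * z) ∧
      (∀ i, σ (u i) = S.autGen u j i) ∧ ∀ i, δ (u i) = if i = j then 1 else 0 := by
    obtain ⟨n1, n2, n3, n4, n5⟩ := id hn
    apply h.exists_twisted_derivation b hb (h.affine_autGen hn hc hq j) <;> fin_cases j <;>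
      simp [PBWScalars.autGen, autCoeff, autShift, smul_smul, n1, n2, n3, n4, n5]
  obtain ⟨σ, δ, h1, h2, h3⟩ := hex
  have hr : ∀ i, S.autCoeff j i ≠ 0 := by
    obtain ⟨n1, n2, n3, n4, n5⟩ := hn
    intro i
    fin_cases j <;> fin_cases i <;> simp [autCoeff, n1, n2, n3, n4, n5]
  exact ⟨AlgEquiv.ofBijective σ (h.bijective_of_affine b hb σ hr h2), δ, h1, h2, h3⟩

end PBWScalars

/-! ### Connectedness and assembly of the calculus -/

section Assemble

variable {𝕜 : Type u} [Field 𝕜] {A : Type v} [Ring A] [Algebra 𝕜 A]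

/-- If `δ` lowers the exponent `w` of the basis elements occurring in `y`, then only basis elements
of exponent zero occur in an element `y` of its kernel. -/
theorem Module.Basis.repr_eq_zero_of_map_eq_zero [CharZero 𝕜] {I : Type*} (b : Module.Basis I 𝕜 A)
    (δ : A →ₗ[𝕜] A) (w : I → ℕ) (g : I → I)
    (hg : ∀ α β, w α ≠ 0 → w β ≠ 0 → g α = g β → α = β) {y : A}
    (hδ : ∀ α, b.repr y α ≠ 0 → δ (b α) = w α • b (g α)) (hy : δ y = 0) {α : I} (hα : w α ≠ 0) :
    b.repr y α = 0 := by
  have h0 : ∑ β ∈ (b.repr y).support, b.repr y β • w β • b (g β) = 0 := by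
    rw [← hy]
    conv_rhs => rw [← b.linearCombination_repr y, Finsupp.linearCombination_apply, Finsupp.sum,
      map_sum]
    refine Finset.sum_congr rfl fun β hβ => ?_
    rw [map_smul, hδ β (Finsupp.mem_support_iff.1 hβ)]
  by_contra hne
  -- In characteristic 0 the nonzero exponent is a nonzero scalar, and `hg` prevents cancellation
  -- between different basis elements.
  simp only [← Nat.cast_smul_eq_nsmul 𝕜] at h0
  have h1 := congrArg (b.coord (g α)) h0
  rw [map_sum, map_zero, Finset.sum_eq_single α] at h1
  · simp [hne, hα] at h1
  · intro β _ hβ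
    by_cases hw : w β = 0
    · simp [hw]
    · have : g β ≠ g α := fun h => hβ (hg β α hw hα h)
      simp [this]
  · intro h
    exact absurd (Finsupp.mem_support_iff.2 hne) h

namespace TwistedPartials

variable {n : ℕ} (D : TwistedPartials 𝕜 A n)

theorem der_pow_self {j : Fin n} (h : D.aut j (D.gen j) = D.gen j) (m : ℕ) :
    D.der j (D.gen j ^ m) = m • D.gen j ^ (m - 1) := by
  induction m with
  | zero => simp [D.der_one]
  | succ m ih =>
    rw [pow_succ, D.der_mul, ih, D.der_gen, if_pos rfl, map_pow, h, mul_one, smul_mul_assoc]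
    rcases m with - | m
    · simp
    · rw [Nat.add_sub_cancel, ← pow_succ, Nat.add_sub_cancel, add_comm, ← succ_nsmul]

theorem der_pow_of_ne {i j : Fin n} (h : i ≠ j) (m : ℕ) : D.der j (D.gen i ^ m) = 0 := by
  induction m with
  | zero => simp [D.der_one]
  | succ m ih => rw [pow_succ, D.der_mul, ih, D.der_gen, if_neg h, mul_zero, zero_mul, add_zero]

/-- The generators are eliminated from left to right. Once the factors in front of uⱼ are gone, no
automorphism acts on a prefix, and ∂ⱼ just lowers the exponent of uⱼ. The factor that appears is the
exponent itself and not a q-analogue, because σⱼ fixes uⱼ. -/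
theorem exists_algebraMap_eq_of_der_eq_zero [CharZero 𝕜] (D : TwistedPartials 𝕜 A 4)
    (haut : ∀ j, D.aut j (D.gen j) = D.gen j) (b : Module.Basis (ℕ × ℕ × ℕ × ℕ) 𝕜 A)
    (hb : ∀ α, b α = pbwMonomial D.gen α) {y : A} (hy : ∀ j, D.der j y = 0) :
    ∃ r : 𝕜, algebraMap 𝕜 A r = y := by
  have h0 : ∀ α, b.repr y α ≠ 0 → α.1 = 0 := by
    intro α
    contrapose!
    refine b.repr_eq_zero_of_map_eq_zero (D.der 0) (fun α => α.1) (fun α => (α.1 - 1, α.2)) ?_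
      (fun α _ => ?_) (hy 0)
    · rintro ⟨a, α⟩ ⟨a', α'⟩ h h' h''
      simp only [Prod.mk.injEq, ne_eq] at *
      exact ⟨by omega, h''.2⟩
    · simp [hb, pbwMonomial, D.der_mul, D.der_pow_self (haut 0), D.der_pow_of_ne, mul_assoc]
  have h1 : ∀ α, b.repr y α ≠ 0 → α.2.1 = 0 := by
    intro α
    contrapose!
    refine b.repr_eq_zero_of_map_eq_zero (D.der 1) (fun α => α.2.1)
      (fun α => (α.1, α.2.1 - 1, α.2.2)) ?_ (fun α hα => ?_) (hy 1)
    · rintro ⟨a, b, α⟩ ⟨a', b', α'⟩ h h' h''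
      simp only [Prod.mk.injEq, ne_eq] at *
      exact ⟨h''.1, by omega, h''.2.2⟩
    · simp [hb, pbwMonomial, D.der_mul, D.der_pow_self (haut 1), D.der_pow_of_ne, mul_assoc, h0 α hα]
  have h2 : ∀ α, b.repr y α ≠ 0 → α.2.2.1 = 0 := by
    intro α
    contrapose!
    refine b.repr_eq_zero_of_map_eq_zero (D.der 2) (fun α => α.2.2.1)
      (fun α => (α.1, α.2.1, α.2.2.1 - 1, α.2.2.2)) ?_ (fun α hα => ?_) (hy 2)
    · rintro ⟨a, b, c, d⟩ ⟨a', b', c', d'⟩ h h' h''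
      simp only [Prod.mk.injEq, ne_eq] at *
      exact ⟨h''.1, h''.2.1, by omega, h''.2.2.2⟩
    · simp [hb, pbwMonomial, D.der_mul, D.der_pow_self (haut 2), D.der_pow_of_ne, mul_assoc, h0 α hα,
        h1 α hα]
  have h3 : ∀ α, b.repr y α ≠ 0 → α.2.2.2 = 0 := by
    intro α
    contrapose!
    refine b.repr_eq_zero_of_map_eq_zero (D.der 3) (fun α => α.2.2.2)
      (fun α => (α.1, α.2.1, α.2.2.1, α.2.2.2 - 1)) ?_ (fun α hα => ?_) (hy 3)
    · rintro ⟨a, b, c, d⟩ ⟨a', b', c', d'⟩ h h' h''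
      simp only [Prod.mk.injEq, ne_eq] at *
      exact ⟨h''.1, h''.2.1, h''.2.2.1, by omega⟩
    · simp [hb, pbwMonomial, D.der_pow_self (haut 3), h0 α hα, h1 α hα, h2 α hα]
  refine ⟨b.repr y (0, 0, 0, 0), ?_⟩
  have hone : b (0, 0, 0, 0) = 1 := by simp [hb, pbwMonomial]
  rw [Algebra.algebraMap_eq_smul_one, ← hone]
  apply b.repr.injective
  ext α
  rw [map_smul, b.repr_self, Finsupp.smul_single, smul_eq_mul, mul_one, Finsupp.single_apply]
  split_ifs with h
  · rw [h]
  · by_contra hne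
    have hne' : b.repr y α ≠ 0 := fun h => hne h.symm
    refine h ?_
    obtain ⟨a, b', c, d⟩ := α
    simp only [Prod.mk.injEq]
    exact ⟨(h0 _ hne').symm, (h1 _ hne').symm, (h2 _ hne').symm, (h3 _ hne').symm⟩

end TwistedPartials

variable {S : PBWScalars 𝕜} {u : Fin 4 → A}

/-- Each commutation rule between the σ's and ∂'s is compatible with products, so it only has to be
verified on the generators. -/
theorem PBWScalars.Commutation.exists_twistedPartials (h : S.Commutation u) (hn : S.Nondegenerate)
    (hc : S.Consistent) (hq : (S.c - 1) * S.q0 = S.q1 * S.q2)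
    (b : Module.Basis (ℕ × ℕ × ℕ × ℕ) 𝕜 A) (hb : ∀ α, b α = pbwMonomial u α) :
    ∃ D : TwistedPartials 𝕜 A 4, D.gen = u ∧ ∀ j, D.aut j (D.gen j) = D.gen j := by
  have htop := adjoin_range_eq_top b hb
  choose σ δ hmul hσ hδ using h.exists_partial hn hc hq b hb
  have hone : ∀ k, δ k 1 = 0 := fun k => by simpa using hmul k 1 1
  have hcoeff : ∀ j k, S.autCoeff j k * S.autCoeff k j = 1 := by
    obtain ⟨n1, n2, n3, n4, n5⟩ := hn
    intro j k
    fin_cases j <;> fin_cases k <;> simp [autCoeff, n1, n2, n3, n4, n5]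
  have hcomm : ∀ i j y, σ i (σ j y) = σ j (σ i y) := by
    intro i j
    have hhom : ((σ i).toAlgHom.comp (σ j).toAlgHom) = (σ j).toAlgHom.comp (σ i).toAlgHom := by
      refine AlgHom.ext_of_adjoin_eq_top htop ?_
      rintro _ ⟨k, rfl⟩
      -- Two affine maps of the same generator commute exactly when their constant terms match in
      -- this way; the overlap identities provide it.
      have hs : S.autCoeff j k * S.autShift i k + S.autShift j k =
          S.autCoeff i k * S.autShift j k + S.autShift i k := by
        obtain ⟨n1, n2, n3, n4, n5⟩ := hn
        obtain ⟨c1, c2, c3, c4, c5, c6, c7, c8, c9, c10, c11, c12, c13, c14, c15, c16, c17, c18⟩ :=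
          hc
        fin_cases i <;> fin_cases j <;> fin_cases k <;> simp [autCoeff, autShift] <;> grind
      change σ i (σ j (u k)) = σ j (σ i (u k))
      rw [hσ, hσ]
      simp only [PBWScalars.autGen, map_add, map_smul, map_one, hσ, smul_add, smul_smul, add_assoc,
        ← add_smul, hs, mul_comm]
    exact fun y => DFunLike.congr_fun hhom y
  have hder_aut : ∀ j k y, δ k (σ j y) = S.autCoeff j k • σ j (δ k y) := by
    intro j k y
    have hy : y ∈ Algebra.adjoin 𝕜 (Set.range u) := htop ▸ Algebra.mem_top
    induction hy using Algebra.adjoin_induction with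
    | mem y hy =>
      obtain ⟨i, rfl⟩ := hy
      rw [hσ, hδ, PBWScalars.autGen, map_add, map_smul, map_smul, hδ, hone]
      split_ifs with hik
      · subst hik; simp
      · simp
    | algebraMap r => simp [Algebra.algebraMap_eq_smul_one, hone]
    | add y z _ _ hy hz => simp [hy, hz]
    | mul y z _ _ hy hz =>
      rw [map_mul, hmul, hmul, hy, hz, map_add, map_mul, map_mul, hcomm k j]
      simp only [smul_mul_assoc, mul_smul_comm, smul_add]
  have hder_der : ∀ j k y, δ k (δ j y) = S.autCoeff j k • δ j (δ k y) := by
    intro j k y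
    have hy : y ∈ Algebra.adjoin 𝕜 (Set.range u) := htop ▸ Algebra.mem_top
    induction hy using Algebra.adjoin_induction with
    | mem y hy =>
      obtain ⟨i, rfl⟩ := hy
      rw [hδ, hδ]
      split_ifs <;> simp [hone]
    | algebraMap r => simp [Algebra.algebraMap_eq_smul_one, hone]
    | add y z _ _ hy hz => simp [hy, hz]
    | mul y z _ _ hy hz =>
      rw [hmul, hmul, map_add, map_add, hmul, hmul, hmul, hmul, hy, hz, hder_aut j k,
        hder_aut k j, hcomm k j]
      simp only [smul_mul_assoc, mul_smul_comm, smul_add, smul_smul, hcoeff, one_smul]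
      abel
  refine ⟨⟨σ, δ, S.autCoeff, u, fun i j => AlgEquiv.ext (hcomm i j), hmul, hder_aut, hder_der,
    hcoeff, fun j i => hδ j i⟩, rfl, fun j => ?_⟩
  change σ j (u j) = u j
  rw [hσ]
  fin_cases j <;> simp [PBWScalars.autGen, autCoeff, autShift]

end Assemble

theorem theorem4p2 {𝕜 : Type u} [Field 𝕜] [CharZero 𝕜] {A : Type v} [Ring A] [Algebra 𝕜 A]
    (ι : MvPolynomial (Fin 2) 𝕜 →ₐ[𝕜] A) (x : Fin 2 → A)
    (hA : IsSkewPBWExtension (ι : MvPolynomial (Fin 2) 𝕜 →+* A) x)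
    (S : PBWScalars 𝕜) (hrel : S.Relations ι x) (hS : S.IsAdmissible) :
    IsDifferentiallySmooth 𝕜 A := by
  obtain ⟨b, hb⟩ := hA.exists_basis ι x
  have : Nontrivial A := ⟨b (0, 0, 0, 0), b (1, 0, 0, 0), b.injective.ne (by simp)⟩
  have hcom := hrel.commutation
  have hn := hrel.nondegenerate
  obtain ⟨D, hgen, haut⟩ := hcom.exists_twistedPartials hn (hcom.consistent hn b hb)
    hS.c_sub_one_mul_q0 b hb
  refine ⟨⟨?_⟩, 4, ?_, D.calculus, D.calculus_hasDimension, ?_, D.calculus_isIntegrable⟩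
  · rw [← adjoin_range_eq_top b hb]
    exact Subalgebra.fg_def.2 ⟨_, Set.finite_range _, rfl⟩
  · exact_mod_cast hcom.gelfandKirillovDim_eq b hb
  · exact D.calculus_isConnected fun y hy =>
      D.exists_algebraMap_eq_of_der_eq_zero haut b (by rwa [hgen]) hy
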